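/- Let $q\geq1$ be an integer and, for $x\in[-1,1]$, let $$F_q(x)=\mathrm{B}\big(\tfrac12,\tfrac q2\big)^{-1}\int_{-1}^x(1-t^2)^{q/2-1}\,\mathrm{d}t$$ be the distribution function of the projection on a fixed direction of a uniform random point of the unit sphere of $\mathbb{R}^{q+1}$, where $\mathrm{B}(a,b)=\Gamma(a)\Gamma(b)/\Gamma(a+b)$. Let $\psi_q^{\mathrm{AD}}$ be the Anderson--Darling kernel, that is, for $\theta\in(0,\pi]$, $$\psi_1^{\mathrm{AD}}(\theta)=-2\log(2\pi)+\frac1\pi\big\{\theta\log\theta+(2\pi-\theta)\log(2\pi-\theta)\big\},$$ and, for $q\geq2$, $$\psi_q^{\mathrm{AD}}(\theta)=-\log 4+4\int_0^{\cos(\theta/2)}\log\Big(\frac{F_q(t)}{1-F_q(t)}\Big)\Big(1-F_{q-1}\Big(\frac{t\tan(\theta/2)}{(1-t^2)^{1/2}}\Big)\Big)\,\mathrm{d}F_q(t),$$ with $\psi_q^{\mathrm{AD}}(0)=0$. Its Gegenbauer (for $q=1$, Chebyshev) coefficients are, for $k\geq0$, $$b_{k,1}^{\mathrm{AD}}=\frac1{c_{k,1}}\int_0^\pi\psi_1^{\mathrm{AD}}(\theta)\,T_k(\cos\theta)\,\mathrm{d}\theta,\qquad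 b_{k,q}^{\mathrm{AD}}=\frac1{c_{k,q}}\int_0^\pi\psi_q^{\mathrm{AD}}(\theta)\,C_k^{(q-1)/2}(\cos\theta)\sin^{q-1}\theta\,\mathrm{d}\theta\quad(q\geq2),$$ where $T_k$ is the $k$-th Chebyshev polynomial of the first kind, $C_k^{\alpha}$ is the $k$-th Gegenbauer polynomial of order $\alpha$, $c_{k,1}=(1+\delta_{k0})\pi/2$ and $$c_{k,q}=\frac{2^{3-q}\pi\,\Gamma(q+k-1)}{(q+2k-1)\,k!\,\Gamma((q-1)/2)^2}\quad(q\geq2).$$ Then, for every integer $k\geq1$, $$b_{k,1}^{\mathrm{AD}}=\frac1{\pi k^2}\int_0^\pi\frac{1-\cos(2k\theta)}{(\pi-\theta)\,\theta}\,\mathrm{d}\theta,\qquad b_{k,2}^{\mathrm{AD}}=\frac1{k(k+1)},$$ and $b_{0,q}^{\mathrm{AD}}=-1$ for every $q\geq1$. Therefore $b_{k,q}^{\mathrm{AD}}>0$ for all $k\geq1$ and $q=1,2$. -/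

import Mathlib

open Polynomial

noncomputable section

/-- The Gegenbauer (ultraspherical) polynomials `C_k^α`, by their three-term recurrence
`C_0^α = 1`, `C_1^α = 2 α X`,
`(k + 2) C_{k+2}^α = 2 (k + 1 + α) X C_{k+1}^α - (k + 2 α) C_k^α`. -/
def gegenbauerPoly (α : ℝ) : ℕ → ℝ[X]
  | 0 => 1
  | 1 => C (2 * α) * X
  | k + 2 =>
      C (2 * ((k : ℝ) + 1 + α) / ((k : ℝ) + 2)) * X * gegenbauerPoly α (k + 1)
        - C (((k : ℝ) + 2 * α) / ((k : ℝ) + 2)) * gegenbauerPoly α k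

/-- The density on `[-1, 1]` of the projection onto a fixed direction of a uniform random point of
the unit sphere of `ℝ^(q+1)`: `t ↦ B(1/2, q/2)⁻¹ (1 - t²)^(q/2 - 1)`. -/
def projDensity (q : ℕ) (t : ℝ) : ℝ :=
  (ProbabilityTheory.beta (1 / 2) ((q : ℝ) / 2))⁻¹ * (1 - t ^ 2) ^ ((q : ℝ) / 2 - 1)

/-- The cumulative distribution function `F_q` of that projection, for `x ∈ [-1, 1]`. -/
def projCdf (q : ℕ) (x : ℝ) : ℝ := ∫ t in (-1)..x, projDensity q t

/-- The Anderson--Darling kernel `ψ_q^AD` at an angle `θ ∈ [0, π]`: in closed form for `q = 1`,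
and through an integral against `dF_q(t)` for `q ≥ 2`. (The formulas give the value `0` at
`θ = 0`, which is also the limit as `θ → 0+`.) -/
def psiAD (q : ℕ) (θ : ℝ) : ℝ :=
  if q = 1 then
    -2 * Real.log (2 * Real.pi)
      + 1 / Real.pi
        * (θ * Real.log θ + (2 * Real.pi - θ) * Real.log (2 * Real.pi - θ))
  else
    -Real.log 4
      + 4 * ∫ t in (0 : ℝ)..Real.cos (θ / 2),
          Real.log (projCdf q t / (1 - projCdf q t))
            * (1 - projCdf (q - 1) (t * Real.tan (θ / 2) / Real.sqrt (1 - t ^ 2)))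
            * projDensity q t

/-- The normalizing constants `c_{k,q}`: the squared norm of the Chebyshev polynomial `T_k`
(`q = 1`) or of `C_k^((q-1)/2)` (`q ≥ 2`) in `L²([-1, 1], (1 - z²)^(q/2 - 1) dz)`. -/
def gegenbauerNorm (q k : ℕ) : ℝ :=
  if q = 1 then
    (1 + if k = 0 then 1 else 0) * Real.pi / 2
  else
    (2 : ℝ) ^ (3 - (q : ℝ)) * Real.pi * Real.Gamma ((q : ℝ) + k - 1)
      / (((q : ℝ) + 2 * k - 1) * (k.factorial : ℝ) * Real.Gamma (((q : ℝ) - 1) / 2) ^ 2)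

/-- The `k`-th Gegenbauer coefficient in dimension `q ≥ 1` (Chebyshev coefficient if `q = 1`) of a
function `ψ` of the angle `θ ∈ [0, π]`. -/
def gegenbauerCoeff (q : ℕ) (ψ : ℝ → ℝ) (k : ℕ) : ℝ :=
  if q = 1 then
    1 / gegenbauerNorm 1 k
      * ∫ θ in (0 : ℝ)..Real.pi, ψ θ * (Polynomial.Chebyshev.T ℝ (k : ℤ)).eval (Real.cos θ)
  else
    1 / gegenbauerNorm q k
      * ∫ θ in (0 : ℝ)..Real.pi,
          ψ θ * (gegenbauerPoly (((q : ℝ) - 1) / 2) k).eval (Real.cos θ) * Real.sin θ ^ (q - 1)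

/-- The coefficients `b_{k,q}^AD`. -/
def coeffAD (q k : ℕ) : ℝ := gegenbauerCoeff q (psiAD q) k

end

/-! Circle (q = 1). The two terms of the kernel are exchanged by θ ↦ 2π − θ, which fixes cos kθ, so
the coefficient unfolds to ∫ x log x cos kx over [0, 2π]. Two integrations by parts turn this into
k⁻² ∫ (1 − cos kx)/x, and the stated integral is the same one after partial fractions
(`coeffAD_one`).

Sphere (q = 2). The kernel has the closed form −2 log(1 + sin(θ/2)) (`psiAD_two`): 1 − F_1 is an
arccosine, which is written as the integral of its derivative in the parameter b = cos(θ/2), and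
Tonelli leaves elementary integrals (`integral_log_mul_arccos_capCos`). With y = sin(θ/2),
Legendre's differential equation and an integration by parts reduce the coefficient to ∫ P_k(1 −
2y²) dy = 1/(2k + 1) over [0, 1].

Zeroth coefficient. Tonelli lets θ be integrated first. The θ-integral of (1 − F_{q−1}) sin^{q−1} θ
is a constant B times 1 − F_q(t), because two half-planes at distance t from the origin cut regions
of equal rotation-invariant weight from the unit disc (`lintegral_Ioo_mul_one_sub_projCdf`).
Substituting u = F_q(t) leaves ∫ (1 − u) log(u/(1 − u)) du over [1/2, 1], which equals −1/4 + (log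
2)/2; the logarithms cancel and −1 remains (`coeffAD_zero`). -/

/-! ### The circle: Chebyshev coefficients for q = 1. -/

lemma one_sub_cos_div_eq_sin_mul_sinc (k x : ℝ) :
    (1 - Real.cos (k * x)) / x = k * (Real.sin (k * x / 2) * Real.sinc (k * x / 2)) := by
  rcases eq_or_ne x 0 with rfl | hx
  · simp
  rcases eq_or_ne k 0 with rfl | hk
  · simp
  have h : Real.cos (k * x) = 1 - 2 * Real.sin (k * x / 2) ^ 2 := by
    rw [← Real.cos_sq_add_sin_sq (k * x / 2), show k * x = 2 * (k * x / 2) by ring, Real.cos_two_mul]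
    rw [show 2 * (k * x / 2) / 2 = k * x / 2 by ring]
    linarith [Real.cos_sq_add_sin_sq (k * x / 2)]
  rw [Real.sinc_of_ne_zero (by positivity), h]
  field_simp
  ring

/-- The value 0 that division by zero assigns at x = 0 is also the limit there, as the `sinc` form
shows. -/
lemma continuous_one_sub_cos_div (k : ℝ) : Continuous fun x : ℝ => (1 - Real.cos (k * x)) / x := by
  simp_rw [one_sub_cos_div_eq_sin_mul_sinc]
  have := Real.continuous_sinc
  fun_prop

lemma integral_mul_log_mul_cos (k : ℕ) (hk : 1 ≤ k) :
    ∫ x in (0 : ℝ)..2 * Real.pi, x * Real.log x * Real.cos (k * x)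
      = 1 / (k : ℝ) ^ 2 * ∫ x in (0 : ℝ)..2 * Real.pi, (1 - Real.cos (k * x)) / x := by
  have hk0 : (k : ℝ) ≠ 0 := by positivity
  have hc := Real.continuous_mul_log
  have hd := continuous_one_sub_cos_div k
  have hpi := Real.pi_pos
  have key : ∫ x in (0 : ℝ)..2 * Real.pi,
      (x * Real.log x * Real.cos (k * x) - 1 / (k : ℝ) ^ 2 * ((1 - Real.cos (k * x)) / x)) = 0 := by
    rw [intervalIntegral.integral_eq_sub_of_hasDerivAt_of_le (by positivity)
      -- Away from 0 this is x log x sin(kx)/k − (log x + 1)(1 − cos kx)/k². Grouping it by x log x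
      -- and (1 − cos kx)/x, both continuous, gives continuity at 0.
      (f := fun x => x * Real.log x * Real.sin (k * x) / k
        - (x * Real.log x * ((1 - Real.cos (k * x)) / x) + (1 - Real.cos (k * x))) / (k : ℝ) ^ 2)]
    · have h1 : Real.sin (k * (2 * Real.pi)) = 0 := by
        simpa using Real.sin_nat_mul_pi (2 * k) |> fun h => by
          rw [← h]; push_cast; ring_nf
      have h2 : Real.cos (k * (2 * Real.pi)) = 1 := Real.cos_nat_mul_two_pi k
      simp [h1, h2]
    · apply Continuous.continuousOn
      fun_prop
    · intro x hx
      have hx0 : x ≠ 0 := hx.1.ne'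
      have e : (fun x => x * Real.log x * Real.sin (k * x) / k
        - (x * Real.log x * ((1 - Real.cos (k * x)) / x) + (1 - Real.cos (k * x))) / (k : ℝ) ^ 2)
        = fun x => x * Real.log x * Real.sin (k * x) / k
        - ((Real.log x + 1) * (1 - Real.cos (k * x))) / (k : ℝ) ^ 2 := by
        ext y
        rcases eq_or_ne y 0 with rfl | hy
        · simp
        · field_simp
      rw [e]
      have l := Real.hasDerivAt_log hx0
      have kx : HasDerivAt (fun x : ℝ => k * x) k x := by
        simpa using (hasDerivAt_id x).const_mul (k : ℝ)
      have := (((hasDerivAt_id x).mul l).mul kx.sin).div_const (k : ℝ) |>.sub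
        (((l.add_const 1).mul (kx.cos.const_sub 1)).div_const ((k : ℝ) ^ 2))
      refine this.congr_deriv ?_
      simp only [id_eq, Pi.mul_apply]
      field_simp
      ring
    · apply Continuous.intervalIntegrable
      fun_prop
  rw [intervalIntegral.integral_sub, intervalIntegral.integral_const_mul] at key
  · linarith
  · apply Continuous.intervalIntegrable; fun_prop
  · apply Continuous.intervalIntegrable; fun_prop

lemma integral_mul_log (b : ℝ) (hb : 0 ≤ b) :
    ∫ x in (0 : ℝ)..b, x * Real.log x = b ^ 2 * Real.log b / 2 - b ^ 2 / 4 := by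
  have hc := Real.continuous_mul_log
  rw [intervalIntegral.integral_eq_sub_of_hasDerivAt_of_le hb
      (f := fun x => x * (x * Real.log x) / 2 - x ^ 2 / 4)]
  · simp; ring
  · apply Continuous.continuousOn
    fun_prop
  · intro x hx
    have hx0 : x ≠ 0 := hx.1.ne'
    have l := Real.hasDerivAt_log hx0
    have := (((hasDerivAt_id x).mul ((hasDerivAt_id x).mul l)).div_const 2).sub
      ((hasDerivAt_pow 2 x).div_const 4)
    refine this.congr_deriv ?_
    simp only [id_eq, Pi.mul_apply]
    field_simp
    ring
  · apply Continuous.intervalIntegrable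
    fun_prop

/-- Reflection about π carries θ log θ on [π, 2π] to the second term of the kernel on [0, π] and
preserves cos kθ. -/
lemma integral_psiAD_one_mul_cos (k : ℕ) :
    ∫ θ in (0 : ℝ)..Real.pi, psiAD 1 θ * Real.cos (k * θ)
      = -2 * Real.log (2 * Real.pi) * (∫ θ in (0 : ℝ)..Real.pi, Real.cos (k * θ))
        + 1 / Real.pi * ∫ x in (0 : ℝ)..2 * Real.pi, x * Real.log x * Real.cos (k * x) := by
  have hc := Real.continuous_mul_log
  have hc' : Continuous fun θ => (2 * Real.pi - θ) * Real.log (2 * Real.pi - θ) :=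
    hc.comp (continuous_const.sub continuous_id)
  have split : ∫ x in (0 : ℝ)..2 * Real.pi, x * Real.log x * Real.cos (k * x)
      = (∫ x in (0 : ℝ)..Real.pi, x * Real.log x * Real.cos (k * x))
        + ∫ x in (0 : ℝ)..Real.pi, (2 * Real.pi - x) * Real.log (2 * Real.pi - x)
            * Real.cos (k * x) := by
    rw [← intervalIntegral.integral_add_adjacent_intervals (b := Real.pi)]
    · congr 1
      have := intervalIntegral.integral_comp_sub_left (a := 0) (b := Real.pi)
        (fun x : ℝ => x * Real.log x * Real.cos (k * x)) (2 * Real.pi)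
      rw [show 2 * Real.pi - Real.pi = Real.pi by ring, sub_zero] at this
      rw [← this]
      congr 1
      ext x
      congr 1
      rw [mul_sub, Real.cos_nat_mul_two_pi_sub]
    all_goals apply Continuous.intervalIntegrable; fun_prop
  rw [split, mul_add, ← intervalIntegral.integral_const_mul, ← intervalIntegral.integral_const_mul,
    ← intervalIntegral.integral_const_mul, ← intervalIntegral.integral_add,
    ← intervalIntegral.integral_add]
  · congr 1
    ext θ
    simp only [psiAD, if_true]
    ring
  all_goals apply Continuous.intervalIntegrable; fun_prop

lemma coeffAD_one_zero : coeffAD 1 0 = -1 := by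
  have h := integral_psiAD_one_mul_cos 0
  simp only [Nat.cast_zero, zero_mul, Real.cos_zero, mul_one] at h
  rw [integral_mul_log _ (by positivity)] at h
  have hpi := Real.pi_ne_zero
  simp [coeffAD, gegenbauerCoeff, gegenbauerNorm, h]
  field_simp
  ring

/-- By partial fractions 1/((π − θ)θ) = (1/π)(1/θ + 1/(π − θ)). The two halves agree under θ ↦ π −
θ, and x = 2θ gives the right side. -/
lemma integral_one_sub_cos_div_mul (k : ℕ) :
    ∫ θ in (0 : ℝ)..Real.pi, (1 - Real.cos (2 * k * θ)) / ((Real.pi - θ) * θ)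
      = 2 / Real.pi * ∫ x in (0 : ℝ)..2 * Real.pi, (1 - Real.cos (k * x)) / x := by
  have hd := continuous_one_sub_cos_div (2 * k)
  have hd' : Continuous fun θ => (1 - Real.cos (2 * k * (Real.pi - θ))) / (Real.pi - θ) :=
    hd.comp (continuous_const.sub continuous_id)
  have hpi := Real.pi_ne_zero
  have hsym (θ : ℝ) : Real.cos (2 * k * (Real.pi - θ)) = Real.cos (2 * k * θ) := by
    rw [show 2 * k * (Real.pi - θ) = k * (2 * Real.pi) - 2 * k * θ by ring,
      Real.cos_nat_mul_two_pi_sub]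
  have e (θ : ℝ) : (1 - Real.cos (2 * k * θ)) / ((Real.pi - θ) * θ)
      = 1 / Real.pi * ((1 - Real.cos (2 * k * θ)) / θ
        + (1 - Real.cos (2 * k * (Real.pi - θ))) / (Real.pi - θ)) := by
    rw [hsym]
    -- At θ = 0 and θ = π the numerators vanish and x / 0 = 0, so the identity survives at the
    -- endpoints.
    rcases eq_or_ne θ 0 with rfl | h0
    · simp
    rcases eq_or_ne (Real.pi - θ) 0 with h1 | h1
    · rw [h1, ← hsym, h1]; simp
    field_simp
    ring
  have r : ∫ θ in (0 : ℝ)..Real.pi, (1 - Real.cos (2 * k * (Real.pi - θ))) / (Real.pi - θ)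
      = ∫ θ in (0 : ℝ)..Real.pi, (1 - Real.cos (2 * k * θ)) / θ := by
    rw [intervalIntegral.integral_comp_sub_left (fun θ => (1 - Real.cos (2 * k * θ)) / θ)]
    simp
  have s : ∫ θ in (0 : ℝ)..Real.pi, (1 - Real.cos (2 * k * θ)) / θ
      = ∫ x in (0 : ℝ)..2 * Real.pi, (1 - Real.cos (k * x)) / x := by
    have := intervalIntegral.mul_integral_comp_mul_left (a := 0) (b := Real.pi)
      (f := fun x => (1 - Real.cos (k * x)) / x) (c := 2)
    rw [mul_zero] at this
    rw [← this, ← intervalIntegral.integral_const_mul]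
    congr 1
    ext x
    rw [show (k : ℝ) * (2 * x) = 2 * k * x by ring]
    rcases eq_or_ne x 0 with rfl | h0
    · simp
    field_simp
  simp_rw [e]
  rw [intervalIntegral.integral_const_mul, intervalIntegral.integral_add, r, s]
  · ring
  all_goals apply Continuous.intervalIntegrable; fun_prop

lemma coeffAD_one (k : ℕ) (hk : 1 ≤ k) :
    coeffAD 1 k = 1 / (Real.pi * (k : ℝ) ^ 2)
      * ∫ θ in (0 : ℝ)..Real.pi, (1 - Real.cos (2 * k * θ)) / ((Real.pi - θ) * θ) := by
  have hk0 : (k : ℝ) ≠ 0 := by positivity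
  have hk1 : k ≠ 0 := by omega
  have h := integral_psiAD_one_mul_cos k
  have hz : ∫ θ in (0 : ℝ)..Real.pi, Real.cos (k * θ) = 0 := by
    rw [intervalIntegral.integral_comp_mul_left (fun x => Real.cos x) hk0]
    simp [Real.sin_nat_mul_pi]
  rw [hz, integral_mul_log_mul_cos k hk] at h
  have hpi := Real.pi_ne_zero
  rw [integral_one_sub_cos_div_mul]
  simp only [coeffAD, gegenbauerCoeff, if_true, gegenbauerNorm, hk1, if_false,
    Polynomial.Chebyshev.T_real_cos, Int.cast_natCast, h]
  field_simp
  ring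

lemma integral_one_sub_cos_div_pos (k : ℕ) (hk : 1 ≤ k) :
    0 < ∫ x in (0 : ℝ)..2 * Real.pi, (1 - Real.cos (k * x)) / x := by
  have hk0 : (0 : ℝ) < k := by positivity
  have hpi := Real.pi_pos
  apply intervalIntegral.integral_pos (by positivity) (continuous_one_sub_cos_div k).continuousOn
  · intro x hx
    exact div_nonneg (sub_nonneg.2 (Real.cos_le_one _)) hx.1.le
  -- At x = π/k the cosine is −1, so the integrand is strictly positive there.
  · refine ⟨Real.pi / k, ⟨by positivity, ?_⟩, ?_⟩
    · rw [div_le_iff₀ hk0]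
      have : (1 : ℝ) ≤ k := by exact_mod_cast hk
      nlinarith
    · rw [mul_div_cancel₀ _ hk0.ne', Real.cos_pi]
      positivity

lemma coeffAD_one_pos (k : ℕ) (hk : 1 ≤ k) : 0 < coeffAD 1 k := by
  have := integral_one_sub_cos_div_pos k hk
  have hk0 : (0 : ℝ) < k := by positivity
  rw [coeffAD_one k hk, integral_one_sub_cos_div_mul]
  positivity

/-! ### Legendre polynomials and the coefficients for q = 2, given the closed form of the kernel. -/

/-- The Legendre polynomials, as Gegenbauer polynomials of order `1 / 2`. -/
noncomputable abbrev legendrePoly (k : ℕ) : ℝ[X] := gegenbauerPoly (1 / 2) k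

lemma legendrePoly_recurrence (k : ℕ) :
    C ((k : ℝ) + 2) * legendrePoly (k + 2)
      = C (2 * (k : ℝ) + 3) * X * legendrePoly (k + 1) - C ((k : ℝ) + 1) * legendrePoly k := by
  have h : (k : ℝ) + 2 ≠ 0 := by positivity
  rw [legendrePoly, gegenbauerPoly, mul_sub, ← mul_assoc, ← mul_assoc, ← mul_assoc, ← C_mul, ← C_mul]
  congr 5
  · field_simp; ring
  · field_simp

/-- The identities are proved jointly because the inductive step of the first uses both. -/
lemma legendrePoly_derivative (k : ℕ) :
    X * derivative (legendrePoly (k + 1)) - derivative (legendrePoly k)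
        = C ((k : ℝ) + 1) * legendrePoly (k + 1) ∧
      derivative (legendrePoly (k + 1)) - X * derivative (legendrePoly k)
        = C ((k : ℝ) + 1) * legendrePoly k := by
  induction k with
  | zero => simp [legendrePoly, gegenbauerPoly]
  | succ k ih =>
    obtain ⟨h1, h2⟩ := ih
    have hC : C ((k : ℝ) + 2) ≠ 0 := by
      rw [Ne, C_eq_zero]; positivity
    have r := legendrePoly_recurrence k
    have r' := congrArg derivative r
    simp only [derivative_mul, derivative_C, zero_mul, zero_add, derivative_sub, derivative_X,
      mul_one] at r'
    push_cast
    simp only [map_add, map_mul, map_ofNat, map_one, map_natCast] at *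
    constructor <;> apply mul_left_cancel₀ hC
    · linear_combination X * r' + (k + 1) * X * h1 + (k + 2) * (X * h1 - h2) - (k + 2) * r
    · linear_combination r' + (k + 1) * h1

lemma one_sub_sq_mul_derivative_legendrePoly (k : ℕ) :
    derivative ((1 - X ^ 2) * derivative (legendrePoly k))
      = -(C ((k : ℝ) * (k + 1)) * legendrePoly k) := by
  cases k with
  | zero => simp [legendrePoly, gegenbauerPoly]
  | succ k =>
    obtain ⟨h1, h2⟩ := legendrePoly_derivative k
    -- Eliminates P_k' between the two derivative identities; differentiating the result gives
    -- Legendre's equation.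
    have h : (1 - X ^ 2) * derivative (legendrePoly (k + 1))
        = C ((k : ℝ) + 1) * (legendrePoly k - X * legendrePoly (k + 1)) := by
      linear_combination h2 - X * h1
    rw [h]
    simp only [derivative_mul, derivative_C, derivative_sub, derivative_X]
    push_cast
    simp only [map_add, map_mul, map_one, map_natCast] at *
    linear_combination (-(k : ℝ[X]) - 1) * h1

lemma legendrePoly_eval_neg_one (k : ℕ) : (legendrePoly k).eval (-1) = (-1) ^ k := by
  induction k using Nat.twoStepInduction with
  | zero => simp [legendrePoly, gegenbauerPoly]
  | one => simp [legendrePoly, gegenbauerPoly]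
  | more k h0 h1 =>
    have r := congrArg (eval (-1)) (legendrePoly_recurrence k)
    simp only [eval_mul, eval_sub, eval_C, eval_X, h0, h1] at r
    have h : (k : ℝ) + 2 ≠ 0 := by positivity
    apply mul_left_cancel₀ h
    rw [r]
    ring

lemma continuous_eval_one_sub_two_mul_sq (p : ℝ[X]) :
    Continuous fun y : ℝ => p.eval (1 - 2 * y ^ 2) :=
  p.continuous.comp (by fun_prop)

lemma hasDerivAt_eval_one_sub_two_mul_sq (p : ℝ[X]) (y : ℝ) :
    HasDerivAt (fun y : ℝ => p.eval (1 - 2 * y ^ 2))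
      (-(4 * y) * (derivative p).eval (1 - 2 * y ^ 2)) y := by
  have h : HasDerivAt (fun y : ℝ => 1 - 2 * y ^ 2) (-(4 * y)) y := by
    refine (((hasDerivAt_pow 2 y).const_mul 2).const_sub 1).congr_deriv ?_
    simp; ring
  have := (p.hasDerivAt (1 - 2 * y ^ 2)).comp y h
  exact this.congr_deriv (mul_comm _ _)

/-- Let I_k be the integral and D_k that of P_{k+1}' − P_k' at 1 − 2y². Integrating the derivative
of y P_{k+1}(1 − 2y²) gives (2k+3) I_{k+1} − 2 D_k = (−1)^{k+1} (`lin`), while P_{k+2}' − P_k' =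
(2k+3) P_{k+1} gives D_{k+1} + D_k = (2k+3) I_{k+1}. Together they determine D_k (`diff`), hence
I_k. -/
lemma integral_legendrePoly_one_sub_two_mul_sq (k : ℕ) :
    (2 * (k : ℝ) + 1) * ∫ y in (0 : ℝ)..1, (legendrePoly k).eval (1 - 2 * y ^ 2) = 1 := by
  have cont := continuous_eval_one_sub_two_mul_sq
  have parts (k : ℕ) : (∫ y in (0 : ℝ)..1, (legendrePoly (k + 1)).eval (1 - 2 * y ^ 2))
      + ∫ y in (0 : ℝ)..1, -(4 * y ^ 2) * (derivative (legendrePoly (k + 1))).eval (1 - 2 * y ^ 2)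
      = (-1) ^ (k + 1) := by
    rw [← intervalIntegral.integral_add]
    · rw [intervalIntegral.integral_eq_sub_of_hasDerivAt
        (f := fun y => y * (legendrePoly (k + 1)).eval (1 - 2 * y ^ 2))]
      · rw [← legendrePoly_eval_neg_one]
        norm_num
      · intro y _
        refine ((hasDerivAt_id y).mul (hasDerivAt_eval_one_sub_two_mul_sq _ y)).congr_deriv ?_
        simp only [id_eq]
        ring
      · have := cont (legendrePoly (k + 1))
        have := cont (derivative (legendrePoly (k + 1)))
        apply Continuous.intervalIntegrable; fun_prop
    all_goals
      have := cont (legendrePoly (k + 1))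
      have := cont (derivative (legendrePoly (k + 1)))
      apply Continuous.intervalIntegrable; fun_prop
  have lin (k : ℕ) :
      (2 * (k : ℝ) + 3) * (∫ y in (0 : ℝ)..1, (legendrePoly (k + 1)).eval (1 - 2 * y ^ 2))
        - 2 * ∫ y in (0 : ℝ)..1, (derivative (legendrePoly (k + 1)) - derivative (legendrePoly k)).eval
            (1 - 2 * y ^ 2)
      = (-1) ^ (k + 1) := by
    rw [← parts, ← intervalIntegral.integral_const_mul, ← intervalIntegral.integral_const_mul,
      ← intervalIntegral.integral_sub, ← intervalIntegral.integral_add]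
    · congr 1
      ext y
      have h := congrArg (eval (1 - 2 * y ^ 2)) (legendrePoly_derivative k).1
      simp only [eval_mul, eval_sub, eval_C, eval_X] at h ⊢
      linear_combination -2 * h
    all_goals
      have := cont (legendrePoly (k + 1))
      have := cont (derivative (legendrePoly (k + 1)))
      have := cont (derivative (legendrePoly (k + 1)) - derivative (legendrePoly k))
      apply Continuous.intervalIntegrable; fun_prop
  have diff (k : ℕ) : ∫ y in (0 : ℝ)..1,
      (derivative (legendrePoly (k + 1)) - derivative (legendrePoly k)).eval (1 - 2 * y ^ 2)
        = (1 + (-1) ^ k) / 2 := by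
    induction k with
    | zero => simp [legendrePoly, gegenbauerPoly]
    | succ k ih =>
      have e : (∫ y in (0 : ℝ)..1, (derivative (legendrePoly (k + 2))
            - derivative (legendrePoly (k + 1))).eval (1 - 2 * y ^ 2))
          + ∫ y in (0 : ℝ)..1, (derivative (legendrePoly (k + 1))
            - derivative (legendrePoly k)).eval (1 - 2 * y ^ 2)
          = (2 * (k : ℝ) + 3) * ∫ y in (0 : ℝ)..1, (legendrePoly (k + 1)).eval (1 - 2 * y ^ 2) := by
        rw [← intervalIntegral.integral_const_mul, ← intervalIntegral.integral_add]
        · congr 1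
          ext y
          have h := congrArg (eval (1 - 2 * y ^ 2)) (legendrePoly_derivative k).1
          have h' := congrArg (eval (1 - 2 * y ^ 2)) (legendrePoly_derivative (k + 1)).2
          push_cast at h'
          simp only [eval_mul, eval_sub, eval_C, eval_X] at h h' ⊢
          linear_combination h + h'
        all_goals exact (cont _).intervalIntegrable _ _
      have l := lin k
      rw [ih] at e l
      rw [pow_succ] at l ⊢
      linarith
  cases k with
  | zero => simp [legendrePoly, gegenbauerPoly]
  | succ k =>
    have l := lin k
    rw [diff, pow_succ] at l
    push_cast
    linarith

lemma integral_mul_log_mul_legendrePoly (k : ℕ) :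
    (k : ℝ) * (k + 1) * ∫ y in (0 : ℝ)..1,
        4 * y * Real.log (1 + y) * (legendrePoly k).eval (1 - 2 * y ^ 2)
      = (∫ y in (0 : ℝ)..1, 2 * y * (legendrePoly k).eval (1 - 2 * y ^ 2))
        - ∫ y in (0 : ℝ)..1, (legendrePoly k).eval (1 - 2 * y ^ 2) := by
  have c0 := continuous_eval_one_sub_two_mul_sq (legendrePoly k)
  have c1 := continuous_eval_one_sub_two_mul_sq ((1 - X ^ 2) * derivative (legendrePoly k))
  have hl : ContinuousOn (fun y : ℝ => Real.log (1 + y)) (Set.uIcc 0 1) := by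
    apply ContinuousOn.log (by fun_prop)
    intro y hy
    rw [Set.uIcc_of_le zero_le_one] at hy
    linarith [hy.1]
  have key : ∫ y in (0 : ℝ)..1,
      ((k : ℝ) * (k + 1) * (4 * y * Real.log (1 + y) * (legendrePoly k).eval (1 - 2 * y ^ 2))
        - (2 * y * (legendrePoly k).eval (1 - 2 * y ^ 2)
          - (legendrePoly k).eval (1 - 2 * y ^ 2))) = 0 := by
    rw [intervalIntegral.integral_eq_sub_of_hasDerivAt
      -- With x = 1 − 2y² one has (1 − x²)/(1 + y) = 4y²(1 − y). The term (y − y²) P_k(x) cancels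
      -- the P_k' left by differentiating the logarithm, and both terms vanish at y = 0 and y = 1.
      (f := fun y => Real.log (1 + y)
        * ((1 - X ^ 2) * derivative (legendrePoly k)).eval (1 - 2 * y ^ 2)
        + (y - y ^ 2) * (legendrePoly k).eval (1 - 2 * y ^ 2))]
    · norm_num
    · intro y hy
      rw [Set.uIcc_of_le zero_le_one] at hy
      have hy1 : 1 + y ≠ 0 := by linarith [hy.1]
      have d := (((hasDerivAt_id y).const_add 1).log hy1).mul
        (hasDerivAt_eval_one_sub_two_mul_sq ((1 - X ^ 2) * derivative (legendrePoly k)) y)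
      have d' := ((hasDerivAt_id y).sub (hasDerivAt_pow 2 y)).mul
        (hasDerivAt_eval_one_sub_two_mul_sq (legendrePoly k) y)
      refine (d.add d').congr_deriv ?_
      rw [one_sub_sq_mul_derivative_legendrePoly]
      simp only [id_eq, eval_mul, eval_sub, eval_C, eval_X, eval_neg, eval_one, eval_pow,
        Pi.sub_apply]
      field_simp
      push_cast
      ring
    · apply ContinuousOn.intervalIntegrable
      fun_prop
  rw [intervalIntegral.integral_sub, intervalIntegral.integral_const_mul,
    intervalIntegral.integral_sub] at key
  · linarith
  all_goals apply ContinuousOn.intervalIntegrable; fun_prop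

/-- Orthogonality of P_k to constants, in the variable y: Legendre's equation makes the integrand an
exact derivative vanishing at both ends. -/
lemma integral_mul_legendrePoly_one_sub_two_mul_sq (k : ℕ) (hk : 1 ≤ k) :
    ∫ y in (0 : ℝ)..1, 2 * y * (legendrePoly k).eval (1 - 2 * y ^ 2) = 0 := by
  have c0 := continuous_eval_one_sub_two_mul_sq (legendrePoly k)
  have hk0 : (0 : ℝ) < k := by positivity
  have hn : 2 * (k : ℝ) * (k + 1) ≠ 0 := by positivity
  apply mul_left_cancel₀ hn
  rw [← intervalIntegral.integral_const_mul, intervalIntegral.integral_eq_sub_of_hasDerivAt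
      (f := fun y => ((1 - X ^ 2) * derivative (legendrePoly k)).eval (1 - 2 * y ^ 2))]
  · norm_num
  · intro y _
    refine (hasDerivAt_eval_one_sub_two_mul_sq _ y).congr_deriv ?_
    rw [one_sub_sq_mul_derivative_legendrePoly]
    simp only [eval_mul, eval_C, eval_neg]
    ring
  · apply Continuous.intervalIntegrable
    fun_prop

lemma gegenbauerNorm_two (k : ℕ) : gegenbauerNorm 2 k = 2 / (2 * (k : ℝ) + 1) := by
  have h : Real.Gamma ((2 : ℝ) + k - 1) = k.factorial := by
    rw [← Real.Gamma_nat_eq_factorial]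
    ring_nf
  have hf : (k.factorial : ℝ) ≠ 0 := by positivity
  have hp := Real.pi_ne_zero
  have e : ((2 : ℝ) ^ (3 - (2 : ℝ))) = 2 := by norm_num
  have e2 : ((2 : ℝ) - 1) / 2 = 1 / 2 := by norm_num
  have hk : 2 * (k : ℝ) + 1 ≠ 0 := by positivity
  simp only [gegenbauerNorm, Nat.cast_ofNat, h, e, e2, Real.Gamma_one_half_eq,
    Real.sq_sqrt Real.pi_pos.le]
  rw [if_neg (by norm_num), show (2 : ℝ) + 2 * k - 1 = 2 * k + 1 by ring]
  field_simp

/-- Under y = sin(θ/2), cos θ = 1 − 2y² and sin θ dθ = 4y dy. -/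
lemma coeffAD_two_of_psiAD_eq
    (hpsi : ∀ θ ∈ Set.Ioo 0 Real.pi, psiAD 2 θ = -2 * Real.log (1 + Real.sin (θ / 2)))
    (k : ℕ) (hk : 1 ≤ k) : coeffAD 2 k = 1 / ((k : ℝ) * (k + 1)) := by
  have hk0 : (0 : ℝ) < k := by positivity
  have hl : ContinuousOn (fun y : ℝ => Real.log (1 + y)) (Set.Icc 0 1) := by
    apply ContinuousOn.log (by fun_prop)
    intro y hy
    linarith [hy.1]
  have c0 := continuous_eval_one_sub_two_mul_sq (legendrePoly k)
  have e2 : ((2 : ℝ) - 1) / 2 = 1 / 2 := by norm_num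
  have sub : ∫ θ in (0 : ℝ)..Real.pi,
      psiAD 2 θ * (legendrePoly k).eval (Real.cos θ) * Real.sin θ
      = -2 * ∫ y in (0 : ℝ)..1, 4 * y * Real.log (1 + y) * (legendrePoly k).eval (1 - 2 * y ^ 2) := by
    have e := intervalIntegral.integral_comp_mul_deriv'' (a := 0) (b := Real.pi)
      (f := fun θ => Real.sin (θ / 2)) (f' := fun θ => Real.cos (θ / 2) / 2)
      (g := fun y => 4 * y * Real.log (1 + y) * (legendrePoly k).eval (1 - 2 * y ^ 2))
      (by fun_prop) ?_ (by fun_prop) ?_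
    · simp only [zero_div, Real.sin_zero, Real.sin_pi_div_two] at e
      rw [← e, ← intervalIntegral.integral_const_mul]
      simp only [intervalIntegral.integral_of_le Real.pi_pos.le,
        MeasureTheory.integral_Ioc_eq_integral_Ioo]
      apply MeasureTheory.setIntegral_congr_fun measurableSet_Ioo
      intro θ hθ
      have h1 : Real.cos θ = 1 - 2 * Real.sin (θ / 2) ^ 2 := by
        rw [← Real.cos_two_mul_eq_one_sub, mul_div_cancel₀ _ two_ne_zero]
      have h2 : Real.sin θ = 2 * Real.sin (θ / 2) * Real.cos (θ / 2) := by
        rw [← Real.sin_two_mul, mul_div_cancel₀ _ two_ne_zero]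
      simp only [Function.comp, hpsi θ hθ, h1, h2]
      ring
    · intro θ _
      apply HasDerivAt.hasDerivWithinAt
      refine (((hasDerivAt_id θ).div_const 2).sin).congr_deriv ?_
      simp only [id_eq]
      ring
    · refine ContinuousOn.mono (s := Set.Icc 0 1) (by fun_prop) ?_
      rintro _ ⟨θ, hθ, rfl⟩
      rw [Set.uIcc_of_le Real.pi_pos.le] at hθ
      exact ⟨Real.sin_nonneg_of_nonneg_of_le_pi (by linarith [hθ.1])
        (by linarith [hθ.2, hθ.1]), Real.sin_le_one _⟩
  have I := integral_legendrePoly_one_sub_two_mul_sq k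
  have J := integral_mul_log_mul_legendrePoly k
  rw [integral_mul_legendrePoly_one_sub_two_mul_sq k hk] at J
  simp only [coeffAD, gegenbauerCoeff, gegenbauerNorm_two]
  simp only [Nat.cast_ofNat, e2, Nat.reduceSub, pow_one]
  rw [if_neg (by norm_num), sub]
  field_simp
  linear_combination (-2 * (k : ℝ) - 1) * J + I

/-! ### Fundamental theorem of calculus and Tonelli for nonnegative integrands. -/

section
open MeasureTheory Set

/-- A nonnegative derivative of a continuous function is automatically integrable, which covers the
endpoint singularities of the arcsine and arccosine derivatives below. -/
lemma lintegral_deriv_eq_sub_of_nonneg {g g' : ℝ → ℝ} {a b : ℝ} (hab : a ≤ b)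
    (hc : ContinuousOn g (Icc a b)) (hd : ∀ x ∈ Ioo a b, HasDerivAt g (g' x) x)
    (h0 : ∀ x ∈ Ioo a b, 0 ≤ g' x) :
    ∫⁻ x in Ioo a b, ENNReal.ofReal (g' x) = ENNReal.ofReal (g b - g a) := by
  have hi := intervalIntegral.integrableOn_deriv_of_nonneg hc hd h0
  rw [← intervalIntegral.integral_eq_sub_of_hasDerivAt_of_le hab hc hd
    ((intervalIntegrable_iff_integrableOn_Ioc_of_le hab).2 hi),
    intervalIntegral.integral_of_le hab, integral_Ioc_eq_integral_Ioo,
    ofReal_integral_eq_lintegral_ofReal (hi.mono_set Ioo_subset_Ioc_self)]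
  exact (ae_restrict_iff' measurableSet_Ioo).2 (ae_of_all _ h0)

lemma integral_deriv_eq_sub_of_nonneg {g g' : ℝ → ℝ} {a b : ℝ} (hab : a ≤ b)
    (hc : ContinuousOn g (Icc a b)) (hd : ∀ x ∈ Ioo a b, HasDerivAt g (g' x) x)
    (h0 : ∀ x ∈ Ioo a b, 0 ≤ g' x) : ∫ x in a..b, g' x = g b - g a :=
  intervalIntegral.integral_eq_sub_of_hasDerivAt_of_le hab hc hd
    ((intervalIntegrable_iff_integrableOn_Ioc_of_le hab).2
      (intervalIntegral.integrableOn_deriv_of_nonneg hc hd h0))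

/-- Tonelli's theorem for a nonnegative real-valued function one of whose partial integrals is a
known integrable function. -/
lemma integrable_and_integral_integral_of_lintegral_eq {α β : Type*} [MeasurableSpace α]
    [MeasurableSpace β] {μ : Measure α} {ν : Measure β} [SFinite μ] [SFinite ν]
    {g : α → β → ℝ} (hg : Measurable (Function.uncurry g)) (g0 : ∀ x y, 0 ≤ g x y)
    {h : β → ℝ} (hh : Integrable h ν) (h0 : 0 ≤ᵐ[ν] h)
    (heq : ∀ᵐ y ∂ν, ∫⁻ x, ENNReal.ofReal (g x y) ∂μ = ENNReal.ofReal (h y)) :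
    Integrable (fun x => ∫ y, g x y ∂ν) μ ∧ ∫ x, ∫ y, g x y ∂ν ∂μ = ∫ y, h y ∂ν := by
  have hm (y : β) : Measurable fun x => g x y := hg.comp measurable_prodMk_right
  have hint : ∀ᵐ y ∂ν, ∫ x, g x y ∂μ = h y := by
    filter_upwards [heq, h0] with y hy hy0
    rw [integral_eq_lintegral_of_nonneg_ae (ae_of_all _ fun x => g0 x y)
      (hm y).aestronglyMeasurable, hy, ENNReal.toReal_ofReal hy0]
  have hp : Integrable (Function.uncurry g) (μ.prod ν) := by
    rw [integrable_prod_iff' hg.aestronglyMeasurable]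
    constructor
    · filter_upwards [heq] with y hy
      refine ⟨(hm y).aestronglyMeasurable, ?_⟩
      simp only [Function.uncurry]
      rw [hasFiniteIntegral_iff_ofReal (ae_of_all _ fun x => g0 x y), hy]
      exact ENNReal.ofReal_lt_top
    · refine hh.congr ?_
      filter_upwards [hint] with y hy
      rw [← hy]
      simp only [Function.uncurry, Real.norm_of_nonneg (g0 _ _)]
  exact ⟨hp.integral_prod_left, by rw [integral_integral_swap hp, integral_congr_ae hint]⟩

end

/-! ### Closed form of the kernel for q = 2. -/

lemma beta_one_half_one_half : ProbabilityTheory.beta (1 / 2) (1 / 2) = Real.pi := by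
  simp only [ProbabilityTheory.beta, Real.Gamma_one_half_eq, Real.mul_self_sqrt Real.pi_pos.le]
  norm_num

lemma beta_one_half_one : ProbabilityTheory.beta (1 / 2) 1 = 2 := by
  have h : Real.Gamma (1 / 2 + 1) = 1 / 2 * Real.Gamma (1 / 2) := Real.Gamma_add_one (by norm_num)
  have h0 : Real.Gamma (1 / 2) ≠ 0 := (Real.Gamma_pos_of_pos (by norm_num)).ne'
  rw [ProbabilityTheory.beta, h, Real.Gamma_one]
  field_simp

lemma projDensity_two (t : ℝ) : projDensity 2 t = 1 / 2 := by
  rw [projDensity, Nat.cast_ofNat, div_self two_ne_zero, beta_one_half_one]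
  simp

lemma projCdf_two (x : ℝ) : projCdf 2 x = (1 + x) / 2 := by
  simp only [projCdf, projDensity_two, intervalIntegral.integral_const, smul_eq_mul]
  ring

lemma one_sub_projCdf_one {x : ℝ} (hx : x ∈ Set.Icc (-1 : ℝ) 1) :
    1 - projCdf 1 x = Real.arccos x / Real.pi := by
  have hp := Real.pi_pos
  have h : projCdf 1 x = Real.arcsin x / Real.pi - Real.arcsin (-1) / Real.pi := by
    apply integral_deriv_eq_sub_of_nonneg hx.1 (g := fun x => Real.arcsin x / Real.pi)
    · exact (Real.continuous_arcsin.div_const _).continuousOn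
    · intro t ht
      have ht' : 0 < 1 - t ^ 2 := by nlinarith [ht.1, ht.2, hx.2]
      refine ((Real.hasDerivAt_arcsin ht.1.ne' (ht.2.trans_le hx.2).ne).div_const _).congr_deriv ?_
      rw [projDensity, Nat.cast_one, beta_one_half_one_half,
        show (1 / 2 - 1 : ℝ) = -(1 / 2) by norm_num, Real.rpow_neg ht'.le, ← Real.sqrt_eq_rpow]
      field_simp
    · intro t ht
      have ht' : 0 < 1 - t ^ 2 := by nlinarith [ht.1, ht.2, hx.2]
      rw [projDensity, Nat.cast_one, beta_one_half_one_half]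
      positivity
  rw [h, Real.arcsin_neg_one, Real.arccos]
  field_simp
  ring

/-- The cosine of the angle at which `t` meets the cap of angular radius `θ / 2`, where
`b = cos (θ / 2)`. -/
noncomputable def capCos (b t : ℝ) : ℝ := t * √(1 - b ^ 2) / (b * √(1 - t ^ 2))

section
variable {b t : ℝ}

lemma one_sub_capCos_sq (hb : 0 < b) (hb1 : b < 1) (ht : 0 ≤ t) (htb : t ≤ b) :
    1 - capCos b t ^ 2 = (√(b ^ 2 - t ^ 2) / (b * √(1 - t ^ 2))) ^ 2 := by
  have h1 : 0 < 1 - t ^ 2 := by nlinarith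
  have h2 : 0 ≤ b ^ 2 - t ^ 2 := by nlinarith
  have h3 : 0 ≤ 1 - b ^ 2 := by nlinarith
  rw [capCos, div_pow, div_pow, mul_pow, mul_pow, Real.sq_sqrt h1.le, Real.sq_sqrt h2,
    Real.sq_sqrt h3]
  field_simp
  ring

lemma sqrt_one_sub_capCos_sq (hb : 0 < b) (hb1 : b < 1) (ht : 0 ≤ t) (htb : t ≤ b) :
    √(1 - capCos b t ^ 2) = √(b ^ 2 - t ^ 2) / (b * √(1 - t ^ 2)) := by
  rw [one_sub_capCos_sq hb hb1 ht htb, Real.sqrt_sq (by positivity)]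

lemma capCos_nonneg (hb : 0 < b) (ht : 0 ≤ t) : 0 ≤ capCos b t := by
  rw [capCos]; positivity

lemma capCos_lt_one (hb : 0 < b) (hb1 : b < 1) (ht : 0 ≤ t) (htb : t < b) : capCos b t < 1 := by
  have h1 : 0 < 1 - t ^ 2 := by nlinarith
  have h2 : 0 < b ^ 2 - t ^ 2 := by nlinarith
  have h : 0 < 1 - capCos b t ^ 2 := by
    rw [one_sub_capCos_sq hb hb1 ht htb.le]; positivity
  nlinarith [capCos_nonneg hb ht]

lemma capCos_self (hb : 0 < b) (hb1 : b < 1) : capCos b b = 1 := by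
  have h1 : 0 < 1 - b ^ 2 := by nlinarith
  rw [capCos, div_self (by positivity)]

/-- Differentiating in b rather than t: since the arccosine vanishes at b = t, it is the integral of
this derivative over (t, c), which prepares the exchange of integrals. -/
lemma hasDerivAt_arccos_capCos (ht : 0 < t) (htb : t < b) (hb1 : b < 1) :
    HasDerivAt (fun b => Real.arccos (capCos b t))
      (t / (b * √(1 - b ^ 2) * √(b ^ 2 - t ^ 2))) b := by
  have hb := ht.trans htb
  have h1 : 0 < 1 - t ^ 2 := by nlinarith
  have h2 : 0 < b ^ 2 - t ^ 2 := by nlinarith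
  have h3 : 0 < 1 - b ^ 2 := by nlinarith
  have hd : HasDerivAt (fun b => capCos b t) (-(t / (√(1 - t ^ 2) * b ^ 2 * √(1 - b ^ 2)))) b := by
    have := ((((hasDerivAt_pow 2 b).const_sub 1).sqrt h3.ne').const_mul t).div
      ((hasDerivAt_id b).mul_const √(1 - t ^ 2)) (by simp only [id_eq]; positivity)
    refine this.congr_deriv ?_
    simp only [id_eq]
    field_simp
    rw [Real.sq_sqrt h3.le]
    push_cast
    ring
  have h4 := capCos_lt_one hb hb1 ht.le htb
  have h5 := capCos_nonneg hb ht.le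
  refine ((Real.hasDerivAt_arccos (by linarith) h4.ne).comp b hd).congr_deriv ?_
  rw [sqrt_one_sub_capCos_sq hb hb1 ht.le htb.le]
  field_simp

lemma continuousOn_arccos_capCos {c : ℝ} (ht : 0 < t) (hc : c < 1) :
    ContinuousOn (fun b => Real.arccos (capCos b t)) (Set.Icc t c) := by
  apply Real.continuous_arccos.comp_continuousOn
  apply ContinuousOn.div (by fun_prop) (by fun_prop)
  intro b hb
  have hb0 : 0 < b := by linarith [hb.1]
  have h1 : 0 < 1 - t ^ 2 := by nlinarith [hb.1, hb.2]
  positivity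

/-- A primitive in `t` of `(log (1 + t) - log (1 - t)) * t / √(b² - t²)`. -/
noncomputable def capPrimitive (b t : ℝ) : ℝ :=
  -(√(b ^ 2 - t ^ 2) * (Real.log (1 + t) - Real.log (1 - t))) + 2 * Real.arcsin (t / b)
    - 2 * √(1 - b ^ 2) * Real.arcsin (capCos b t)

lemma hasDerivAt_capPrimitive (ht : 0 < t) (htb : t < b) (hb1 : b < 1) :
    HasDerivAt (capPrimitive b)
      ((Real.log (1 + t) - Real.log (1 - t)) * (t / √(b ^ 2 - t ^ 2))) t := by
  have hb := ht.trans htb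
  have h1 : 0 < 1 - t ^ 2 := by nlinarith
  have h2 : 0 < b ^ 2 - t ^ 2 := by nlinarith
  have h3 : 0 < 1 - b ^ 2 := by nlinarith
  have h6 : 0 < 1 - t := by linarith
  have h7 : 0 < 1 + t := by linarith
  have h4 := capCos_lt_one hb hb1 ht.le htb
  have h5 := capCos_nonneg hb ht.le
  have hd : HasDerivAt (capCos b) (√(1 - b ^ 2) / (b * √(1 - t ^ 2) * (1 - t ^ 2))) t := by
    have := ((hasDerivAt_id t).mul_const √(1 - b ^ 2)).div
      ((((hasDerivAt_pow 2 t).const_sub 1).sqrt h1.ne').const_mul b) (by positivity)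
    refine this.congr_deriv ?_
    simp only [id_eq]
    field_simp
    rw [Real.sq_sqrt h1.le]
    field_simp
    push_cast
    ring
  have ha : HasDerivAt (fun t => Real.arcsin (capCos b t))
      (√(1 - b ^ 2) / ((1 - t ^ 2) * √(b ^ 2 - t ^ 2))) t := by
    refine ((Real.hasDerivAt_arcsin (by linarith) h4.ne).comp t hd).congr_deriv ?_
    rw [sqrt_one_sub_capCos_sq hb hb1 ht.le htb.le]
    field_simp
  have hb' : HasDerivAt (fun t => Real.arcsin (t / b)) (1 / √(b ^ 2 - t ^ 2)) t := by
    have hlt : t / b < 1 := (div_lt_one hb).2 htb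
    have hnn : 0 < t / b := by positivity
    refine ((Real.hasDerivAt_arcsin (by linarith) hlt.ne).comp t
      ((hasDerivAt_id t).div_const b)).congr_deriv ?_
    have : √(1 - (t / b) ^ 2) = √(b ^ 2 - t ^ 2) / b := by
      rw [show 1 - (t / b) ^ 2 = (b ^ 2 - t ^ 2) / b ^ 2 by field_simp, Real.sqrt_div h2.le,
        Real.sqrt_sq hb.le]
    rw [this]
    field_simp
  have hl : HasDerivAt (fun t => Real.log (1 + t) - Real.log (1 - t)) (2 / (1 - t ^ 2)) t := by
    refine ((((hasDerivAt_id t).const_add 1).log h7.ne').sub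
      (((hasDerivAt_id t).const_sub 1).log h6.ne')).congr_deriv ?_
    rw [show 1 - t ^ 2 = (1 - t) * (1 + t) by ring]
    simp only [id_eq]
    field_simp
    ring
  have hs := ((hasDerivAt_pow 2 t).const_sub (b ^ 2)).sqrt h2.ne'
  refine (((hs.mul hl).neg.add (hb'.const_mul 2)).sub
    (ha.const_mul (2 * √(1 - b ^ 2)))).congr_deriv ?_
  field_simp
  rw [Real.sq_sqrt h3.le, Real.sq_sqrt h2.le]
  push_cast
  ring

lemma continuousOn_capPrimitive (hb : 0 < b) (hb1 : b < 1) :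
    ContinuousOn (capPrimitive b) (Set.Icc 0 b) := by
  have hc : ContinuousOn (capCos b) (Set.Icc 0 b) := by
    apply ContinuousOn.div (by fun_prop) (by fun_prop)
    intro t ht
    have h1 : 0 < 1 - t ^ 2 := by nlinarith [ht.1, ht.2]
    positivity
  have h1 : ContinuousOn (fun t : ℝ => Real.log (1 + t)) (Set.Icc 0 b) :=
    ContinuousOn.log (by fun_prop) fun t ht => by linarith [ht.1]
  have h2 : ContinuousOn (fun t : ℝ => Real.log (1 - t)) (Set.Icc 0 b) :=
    ContinuousOn.log (by fun_prop) fun t ht => by linarith [ht.2]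
  have h3 := Real.continuous_arcsin.comp_continuousOn hc
  have h4 : Continuous fun t => Real.arcsin (t / b) := Real.continuous_arcsin.comp (by fun_prop)
  unfold capPrimitive
  simp only [Function.comp_def] at h3
  fun_prop

lemma capPrimitive_sub (hb : 0 < b) (hb1 : b < 1) :
    capPrimitive b b - capPrimitive b 0 = Real.pi * (1 - √(1 - b ^ 2)) := by
  simp only [capPrimitive, capCos_self hb hb1, div_self hb.ne', Real.arcsin_one]
  simp [capCos]
  ring

end

section
open MeasureTheory Set

/-- Replacing the arccosine by an integral in b gives a double integral over 0 < t < b < c. Its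
inner t-integral is evaluated by `capPrimitive`, and the remaining integrand in b is the derivative
of −π log(1 + √(1 − b²)). -/
lemma integral_log_mul_arccos_capCos {c : ℝ} (hc : 0 < c) (hc1 : c < 1) :
    ∫ t in (0 : ℝ)..c, (Real.log (1 + t) - Real.log (1 - t)) * Real.arccos (capCos c t)
      = Real.pi * (Real.log 2 - Real.log (1 + √(1 - c ^ 2))) := by
  have hpi := Real.pi_pos
  set L : ℝ → ℝ := fun t => Real.log (1 + t) - Real.log (1 - t) with hL
  have hL0 {t : ℝ} (h0 : 0 < t) (h1 : t < 1) : 0 ≤ L t :=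
    sub_nonneg.2 (Real.log_le_log (by linarith) (by linarith))
  let K : ℝ → ℝ → ℝ := fun t b => t / (b * √(1 - b ^ 2) * √(b ^ 2 - t ^ 2))
  let S : Set (ℝ × ℝ) := {p | 0 < p.1 ∧ p.1 < p.2 ∧ p.2 < c}
  have hS : MeasurableSet S :=
    (measurableSet_lt measurable_const measurable_fst).inter
      ((measurableSet_lt measurable_fst measurable_snd).inter
        (measurableSet_lt measurable_snd measurable_const))
  -- The indicator of the triangle turns the variable limits into the fixed square (0, c)².
  let g : ℝ → ℝ → ℝ := fun t b => S.indicator (fun p => L p.1 * K p.1 p.2) (t, b)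
  have hg : Measurable (Function.uncurry g) := by
    refine Measurable.indicator ?_ hS
    simp only [hL, K]
    fun_prop
  have g0 (t b : ℝ) : 0 ≤ g t b := by
    refine indicator_nonneg (fun p hp => ?_) _
    have h1 := hp.1
    have h2 : 0 < p.2 := hp.1.trans hp.2.1
    exact mul_nonneg (hL0 hp.1 (by linarith [hp.2.1, hp.2.2])) (by positivity)
  let h : ℝ → ℝ := fun b => Real.pi * (1 - √(1 - b ^ 2)) / (b * √(1 - b ^ 2))
  have hc0 : ContinuousOn (fun b => -(Real.pi * Real.log (1 + √(1 - b ^ 2)))) (Icc 0 c) := by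
    apply ContinuousOn.neg
    apply ContinuousOn.mul (by fun_prop)
    exact ContinuousOn.log (by fun_prop) fun b _ => by positivity
  have hd : ∀ b ∈ Ioo 0 c,
      HasDerivAt (fun b => -(Real.pi * Real.log (1 + √(1 - b ^ 2)))) (h b) b := by
    intro b hb
    have hb0 := hb.1
    have h3 : 0 < 1 - b ^ 2 := by nlinarith [hb.1, hb.2]
    refine ((((((hasDerivAt_pow 2 b).const_sub 1).sqrt h3.ne').const_add 1).log
      (by positivity)).const_mul Real.pi).neg.congr_deriv ?_
    simp only [h]
    field_simp
    push_cast
    linear_combination 2 * Real.sq_sqrt h3.le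
  have h0 : ∀ b ∈ Ioo 0 c, 0 ≤ h b := by
    intro b hb
    have hb0 := hb.1
    have : √(1 - b ^ 2) ≤ 1 := Real.sqrt_le_one.2 (by nlinarith)
    have : 0 ≤ 1 - √(1 - b ^ 2) := by linarith
    simp only [h]
    positivity
  have hint : IntegrableOn h (Ioo 0 c) :=
    (intervalIntegral.integrableOn_deriv_of_nonneg hc0 hd h0).mono_set Ioo_subset_Ioc_self
  have inner_t : ∀ b ∈ Ioo 0 c,
      ∫⁻ t in Ioo 0 c, ENNReal.ofReal (g t b) = ENNReal.ofReal (h b) := by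
    intro b hb
    have hb0 := hb.1
    have hb1 : b < 1 := hb.2.trans hc1
    have e1 (t : ℝ) : ENNReal.ofReal (g t b)
        = (Ioo 0 b).indicator (fun t => ENNReal.ofReal (L t * K t b)) t := by
      by_cases ht : t ∈ Ioo 0 b
      · rw [indicator_of_mem ht]
        simp only [g]
        rw [indicator_of_mem (show (t, b) ∈ S from ⟨ht.1, ht.2, hb.2⟩)]
      · rw [indicator_of_notMem ht]
        simp only [g]
        rw [indicator_of_notMem (fun hm : (t, b) ∈ S => ht ⟨hm.1, hm.2.1⟩), ENNReal.ofReal_zero]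
    simp_rw [e1]
    rw [lintegral_indicator measurableSet_Ioo, Measure.restrict_restrict measurableSet_Ioo,
      inter_eq_left.2 (Ioo_subset_Ioo_right hb.2.le),
      lintegral_deriv_eq_sub_of_nonneg (g := fun t => capPrimitive b t / (b * √(1 - b ^ 2))) hb0.le
        ((continuousOn_capPrimitive hb0 hb1).div_const _)
        (fun t ht => ((hasDerivAt_capPrimitive ht.1 ht.2 hb1).div_const _).congr_deriv (by
          simp only [K, hL]; field_simp))
        (fun t ht => by
          have := hL0 ht.1 (ht.2.trans hb1)
          have := ht.1
          simp only [K]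
          positivity),
      ← sub_div, capPrimitive_sub hb0 hb1]
  have inner_b : ∀ t ∈ Ioo 0 c, ∫ b in Ioo 0 c, g t b = L t * Real.arccos (capCos c t) := by
    intro t ht
    have e1 (b : ℝ) : g t b = (Ioo t c).indicator (fun b => L t * K t b) b := by
      by_cases hb : b ∈ Ioo t c
      · rw [indicator_of_mem hb]
        simp only [g]
        rw [indicator_of_mem (show (t, b) ∈ S from ⟨ht.1, hb.1, hb.2⟩)]
      · rw [indicator_of_notMem hb]
        simp only [g]
        rw [indicator_of_notMem (fun hm : (t, b) ∈ S => hb ⟨hm.2.1, hm.2.2⟩)]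
    simp_rw [e1]
    rw [integral_indicator measurableSet_Ioo, Measure.restrict_restrict measurableSet_Ioo,
      inter_eq_left.2 (Ioo_subset_Ioo_left ht.1.le), integral_const_mul,
      ← integral_Ioc_eq_integral_Ioo, ← intervalIntegral.integral_of_le ht.2.le,
      integral_deriv_eq_sub_of_nonneg ht.2.le (continuousOn_arccos_capCos ht.1 hc1)
        (fun b hb => hasDerivAt_arccos_capCos ht.1 hb.1 (hb.2.trans hc1))
        (fun b hb => by
          have := ht.1
          have := ht.1.trans hb.1
          positivity),
      capCos_self ht.1 (ht.2.trans hc1), Real.arccos_one, sub_zero]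
  have T := (integrable_and_integral_integral_of_lintegral_eq (μ := volume.restrict (Ioo 0 c))
    (ν := volume.restrict (Ioo 0 c)) hg g0 hint
    ((ae_restrict_iff' measurableSet_Ioo).2 (ae_of_all _ h0))
    ((ae_restrict_iff' measurableSet_Ioo).2 (ae_of_all _ inner_t))).2
  rw [setIntegral_congr_fun measurableSet_Ioo inner_b] at T
  rw [intervalIntegral.integral_of_le hc.le, integral_Ioc_eq_integral_Ioo, T,
    ← integral_Ioc_eq_integral_Ioo, ← intervalIntegral.integral_of_le hc.le,
    integral_deriv_eq_sub_of_nonneg hc.le hc0 hd h0]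
  norm_num
  ring

lemma psiAD_two {θ : ℝ} (hθ : θ ∈ Ioo 0 Real.pi) :
    psiAD 2 θ = -2 * Real.log (1 + Real.sin (θ / 2)) := by
  have hc : 0 < Real.cos (θ / 2) :=
    Real.cos_pos_of_mem_Ioo ⟨by linarith [hθ.1, hθ.2], by linarith [hθ.2]⟩
  have hs : 0 < Real.sin (θ / 2) :=
    Real.sin_pos_of_pos_of_lt_pi (by linarith [hθ.1]) (by linarith [hθ.1, hθ.2])
  have hsq := Real.sin_sq_add_cos_sq (θ / 2)
  have hs' : √(1 - Real.cos (θ / 2) ^ 2) = Real.sin (θ / 2) := by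
    rw [← Real.sin_sq, Real.sqrt_sq hs.le]
  have hc1 : Real.cos (θ / 2) < 1 := by nlinarith
  have hpi := Real.pi_ne_zero
  have I := integral_log_mul_arccos_capCos hc hc1
  rw [hs'] at I
  have e : ∫ t in (0 : ℝ)..Real.cos (θ / 2), Real.log (projCdf 2 t / (1 - projCdf 2 t))
            * (1 - projCdf (2 - 1) (t * Real.tan (θ / 2) / √(1 - t ^ 2))) * projDensity 2 t
      = ∫ t in (0 : ℝ)..Real.cos (θ / 2), 1 / (2 * Real.pi) *
        ((Real.log (1 + t) - Real.log (1 - t)) * Real.arccos (capCos (Real.cos (θ / 2)) t)) := by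
    apply intervalIntegral.integral_congr_Ioo_of_le hc.le
    intro t ht
    have ha : t * Real.tan (θ / 2) / √(1 - t ^ 2) = capCos (Real.cos (θ / 2)) t := by
      rw [capCos, hs', Real.tan_eq_sin_div_cos]
      field_simp
    have h1 : 0 < 1 - t := by linarith [ht.2]
    have h2 : 0 < 1 + t := by linarith [ht.1]
    have hl : projCdf 2 t / (1 - projCdf 2 t) = (1 + t) / (1 - t) := by
      rw [projCdf_two, show 1 - (1 + t) / 2 = (1 - t) / 2 by ring]
      field_simp
    simp only [hl, ha, projDensity_two, Nat.reduceSub]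
    rw [one_sub_projCdf_one ⟨by linarith [capCos_nonneg hc ht.1.le],
      (capCos_lt_one hc hc1 ht.1.le ht.2).le⟩, Real.log_div h2.ne' h1.ne']
    field_simp
  -- The term 2 log 2 produced by the integral cancels −log 4.
  rw [psiAD, if_neg (by norm_num), e, intervalIntegral.integral_const_mul, I,
    show (4 : ℝ) = 2 ^ 2 by norm_num, Real.log_pow]
  field_simp
  push_cast
  ring

end

/-! ### The projected distribution F_q for general q. -/

section
open MeasureTheory Set ProbabilityTheory

/-- Legendre's duplication formula. The factor arises from t = 2x − 1, which turns 1 − t² into 4x(1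
− x). -/
lemma beta_one_half_eq_mul_beta_self {a : ℝ} (ha : 0 < a) :
    beta (1 / 2) a = 2 * 4 ^ (a - 1) * beta a a := by
  have d := Real.Gamma_mul_Gamma_add_half a
  have h1 : Real.Gamma a ≠ 0 := (Real.Gamma_pos_of_pos ha).ne'
  have h2 : Real.Gamma (a + 1 / 2) ≠ 0 := (Real.Gamma_pos_of_pos (by linarith)).ne'
  have h3 : Real.Gamma (2 * a) ≠ 0 := (Real.Gamma_pos_of_pos (by linarith)).ne'
  have h4 : (2 : ℝ) * 4 ^ (a - 1) = 2 ^ (2 * a - 1) := by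
    rw [show 2 * a - 1 = 1 + 2 * (a - 1) by ring, Real.rpow_add two_pos, Real.rpow_one,
      Real.rpow_mul two_pos.le]
    norm_num
  have h5 : (2 : ℝ) ^ (2 * a - 1) * 2 ^ (1 - 2 * a) = 1 := by
    rw [← Real.rpow_add (by norm_num)]; simp
  rw [h4, beta, beta, Real.Gamma_one_half_eq, add_comm (1 / 2) a, ← two_mul]
  generalize Real.Gamma (a + 1 / 2) = x at *
  generalize Real.Gamma (2 * a) = y at *
  generalize (2 : ℝ) ^ (2 * a - 1) = z at *
  field_simp
  linear_combination (-z) * d - y * √Real.pi * h5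

lemma lintegral_rpow_mul_one_sub_rpow {a b : ℝ} (ha : 0 < a) (hb : 0 < b) :
    ∫⁻ x in Ioo (0 : ℝ) 1, ENNReal.ofReal (x ^ (a - 1) * (1 - x) ^ (b - 1))
      = ENNReal.ofReal (beta a b) := by
  have h := lintegral_betaPDF_eq_one ha hb
  have hB := beta_pos ha hb
  rw [lintegral_betaPDF] at h
  simp_rw [mul_assoc, ENNReal.ofReal_mul (one_div_pos.2 hB).le] at h
  rw [lintegral_const_mul' _ _ ENNReal.ofReal_ne_top, one_div, ENNReal.ofReal_inv_of_pos hB] at h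
  exact (inv_inj.1 (ENNReal.eq_inv_of_mul_eq_one_left h)).symm

lemma lintegral_one_sub_sq_rpow {a : ℝ} (ha : 0 < a) :
    ∫⁻ t in Ioo (-1 : ℝ) 1, ENNReal.ofReal ((1 - t ^ 2) ^ (a - 1))
      = ENNReal.ofReal (beta (1 / 2) a) := by
  have him : (fun x : ℝ => 2 * x - 1) '' Ioo 0 1 = Ioo (-1) 1 := by
    ext y
    constructor
    · rintro ⟨x, hx, rfl⟩
      exact ⟨by linarith [hx.1], by linarith [hx.2]⟩
    · intro hy
      exact ⟨(y + 1) / 2, ⟨by linarith [hy.1], by linarith [hy.2]⟩, by ring⟩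
  rw [← him, lintegral_image_eq_lintegral_abs_deriv_mul measurableSet_Ioo (f' := fun _ => 2)
    (fun x _ => by
      simpa using (((hasDerivAt_id x).const_mul 2).sub_const 1).hasDerivWithinAt)
    (fun x _ y _ h => by simpa using h), beta_one_half_eq_mul_beta_self ha,
    ENNReal.ofReal_mul (by positivity), ← lintegral_rpow_mul_one_sub_rpow ha ha,
    ← lintegral_const_mul' _ _ ENNReal.ofReal_ne_top]
  apply setLIntegral_congr_fun measurableSet_Ioo
  intro x hx
  have h0 := hx.1
  have h1 : 0 < 1 - x := by linarith [hx.2]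
  simp only
  rw [← ENNReal.ofReal_mul (by positivity), ← ENNReal.ofReal_mul (by positivity),
    show 1 - (2 * x - 1) ^ 2 = 4 * (x * (1 - x)) by ring, Real.mul_rpow (by norm_num) (by positivity),
    Real.mul_rpow h0.le h1.le, abs_of_pos two_pos, mul_assoc]

lemma projDensity_pos {q : ℕ} (hq : 1 ≤ q) {t : ℝ} (ht : t ∈ Ioo (-1 : ℝ) 1) :
    0 < projDensity q t := by
  have h : 0 < 1 - t ^ 2 := by nlinarith [ht.1, ht.2]
  have hB : 0 < beta (1 / 2) ((q : ℝ) / 2) := beta_pos (by norm_num) (by positivity)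
  rw [projDensity]
  positivity

lemma measurable_projDensity (q : ℕ) : Measurable (projDensity q) := by
  unfold projDensity
  fun_prop

lemma lintegral_projDensity {q : ℕ} (hq : 1 ≤ q) :
    ∫⁻ t in Ioo (-1 : ℝ) 1, ENNReal.ofReal (projDensity q t) = 1 := by
  have hB : 0 < beta (1 / 2) ((q : ℝ) / 2) := beta_pos (by norm_num) (by positivity)
  simp_rw [projDensity, ENNReal.ofReal_mul (inv_pos.2 hB).le]
  rw [lintegral_const_mul' _ _ ENNReal.ofReal_ne_top, lintegral_one_sub_sq_rpow (by positivity),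
    ← ENNReal.ofReal_mul (inv_pos.2 hB).le, inv_mul_cancel₀ hB.ne', ENNReal.ofReal_one]

lemma integrableOn_projDensity {q : ℕ} (hq : 1 ≤ q) :
    IntegrableOn (projDensity q) (Ioo (-1 : ℝ) 1) := by
  refine ⟨(measurable_projDensity q).aestronglyMeasurable, ?_⟩
  rw [hasFiniteIntegral_iff_ofReal, lintegral_projDensity hq]
  · exact ENNReal.one_lt_top
  · exact (ae_restrict_iff' measurableSet_Ioo).2 (ae_of_all _ fun t ht => (projDensity_pos hq ht).le)

lemma intervalIntegrable_projDensity {q : ℕ} (hq : 1 ≤ q) {a b : ℝ} (ha : a ∈ Icc (-1 : ℝ) 1)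
    (hb : b ∈ Icc (-1 : ℝ) 1) : IntervalIntegrable (projDensity q) volume a b := by
  have : IntervalIntegrable (projDensity q) volume (-1) 1 := by
    rw [intervalIntegrable_iff_integrableOn_Ioo_of_le (by norm_num)]
    exact integrableOn_projDensity hq
  exact this.mono_set (by
    rw [uIcc_of_le (by norm_num : (-1 : ℝ) ≤ 1)]; exact uIcc_subset_Icc ha hb)

lemma projCdf_one_eq_one {q : ℕ} (hq : 1 ≤ q) : projCdf q 1 = 1 := by
  rw [projCdf, intervalIntegral.integral_of_le (by norm_num), integral_Ioc_eq_integral_Ioo,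
    integral_eq_lintegral_of_nonneg_ae _ (measurable_projDensity q).aestronglyMeasurable,
    lintegral_projDensity hq, ENNReal.toReal_one]
  exact (ae_restrict_iff' measurableSet_Ioo).2 (ae_of_all _ fun t ht => (projDensity_pos hq ht).le)

lemma projCdf_sub_projCdf {q : ℕ} (hq : 1 ≤ q) {a b : ℝ} (ha : a ∈ Icc (-1 : ℝ) 1)
    (hb : b ∈ Icc (-1 : ℝ) 1) : projCdf q b - projCdf q a = ∫ t in a..b, projDensity q t :=
  intervalIntegral.integral_interval_sub_left
    (intervalIntegrable_projDensity hq (by norm_num) hb)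
    (intervalIntegrable_projDensity hq (by norm_num) ha)

lemma projCdf_zero {q : ℕ} (hq : 1 ≤ q) : projCdf q 0 = 1 / 2 := by
  have h := projCdf_sub_projCdf hq (a := 0) (b := 1) (by norm_num) (by norm_num)
  have e : ∫ t in (0 : ℝ)..1, projDensity q t = projCdf q 0 := by
    have := intervalIntegral.integral_comp_neg (a := 0) (b := 1) (projDensity q)
    simpa [projDensity, projCdf] using this
  rw [e, projCdf_one_eq_one hq] at h
  linarith

lemma projCdf_strictMonoOn {q : ℕ} (hq : 1 ≤ q) : StrictMonoOn (projCdf q) (Icc (-1 : ℝ) 1) := by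
  intro a ha b hb hab
  rw [← sub_pos, projCdf_sub_projCdf hq ha hb]
  exact intervalIntegral.intervalIntegral_pos_of_pos_on (intervalIntegrable_projDensity hq ha hb)
    (fun t ht => projDensity_pos hq ⟨ha.1.trans_lt ht.1, ht.2.trans_le hb.2⟩) hab

lemma continuousOn_projCdf {q : ℕ} (hq : 1 ≤ q) : ContinuousOn (projCdf q) (Icc (-1 : ℝ) 1) := by
  have := intervalIntegral.continuousOn_primitive_interval'
    (intervalIntegrable_projDensity hq (a := -1) (b := 1) (by norm_num) (by norm_num))
    (left_mem_uIcc)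
  rwa [uIcc_of_le (by norm_num)] at this

lemma hasDerivAt_projCdf {q : ℕ} (hq : 1 ≤ q) {t : ℝ} (ht : t ∈ Ioo (-1 : ℝ) 1) :
    HasDerivAt (projCdf q) (projDensity q t) t := by
  have h : 1 - t ^ 2 ≠ 0 := by nlinarith [ht.1, ht.2]
  refine intervalIntegral.integral_hasDerivAt_right
    (intervalIntegrable_projDensity hq (by norm_num) ⟨ht.1.le, ht.2.le⟩)
    ((measurable_projDensity q).stronglyMeasurable.stronglyMeasurableAtFilter) ?_
  unfold projDensity
  exact continuousAt_const.mul (ContinuousAt.rpow_const (by fun_prop) (Or.inl h))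

lemma lintegral_Ioo_projDensity {q : ℕ} (hq : 1 ≤ q) {m : ℝ} (hm : m ∈ Icc (-1 : ℝ) 1) :
    ∫⁻ t in Ioo m 1, ENNReal.ofReal (projDensity q t) = ENNReal.ofReal (1 - projCdf q m) := by
  rw [lintegral_deriv_eq_sub_of_nonneg hm.2
    ((continuousOn_projCdf hq).mono (Icc_subset_Icc_left hm.1))
    (fun t ht => hasDerivAt_projCdf hq ⟨hm.1.trans_lt ht.1, ht.2⟩)
    (fun t ht => (projDensity_pos hq ⟨hm.1.trans_lt ht.1, ht.2⟩).le), projCdf_one_eq_one hq]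

lemma lintegral_Ioo_one_sub_sq_rpow {q : ℕ} (hq : 1 ≤ q) {m : ℝ} (hm : m ∈ Icc (-1 : ℝ) 1) :
    ∫⁻ t in Ioo m 1, ENNReal.ofReal ((1 - t ^ 2) ^ ((q : ℝ) / 2 - 1))
      = ENNReal.ofReal (beta (1 / 2) ((q : ℝ) / 2) * (1 - projCdf q m)) := by
  have hB : 0 < beta (1 / 2) ((q : ℝ) / 2) := beta_pos (by norm_num) (by positivity)
  rw [ENNReal.ofReal_mul hB.le, ← lintegral_Ioo_projDensity hq hm,
    ← lintegral_const_mul' _ _ ENNReal.ofReal_ne_top]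
  congr 1
  ext t
  rw [← ENNReal.ofReal_mul hB.le, projDensity, mul_inv_cancel_left₀ hB.ne']

end

/-! ### Rotation invariance on the disc. -/

section
open MeasureTheory Set ProbabilityTheory

/-- The density on the unit disc of the projection to a plane of the uniform measure on the unit
sphere of `ℝ^(p + 2)`, up to normalization. -/
noncomputable def discWeight (p : ℕ) (z : ℂ) : ENNReal :=
  if ‖z‖ < 1 then ENNReal.ofReal ((1 - ‖z‖ ^ 2) ^ ((p : ℝ) / 2 - 1)) else 0

lemma measurable_discWeight (p : ℕ) : Measurable (discWeight p) :=
  Measurable.ite (measurableSet_lt (by fun_prop) measurable_const) (by fun_prop) measurable_const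

/-- The weight depends only on ‖z‖, and multiplication by the unit t − is sends z to a number with
real part t Re z + s Im z. -/
lemma lintegral_discWeight_rotation (p : ℕ) {t s : ℝ} (hts : t ^ 2 + s ^ 2 = 1) :
    ∫⁻ z in {z : ℂ | t < t * z.re + s * z.im}, discWeight p z
      = ∫⁻ z in {z : ℂ | t < z.re}, discWeight p z := by
  have hn : ‖(⟨t, -s⟩ : ℂ)‖ = 1 := by
    rw [← sq_eq_sq₀ (norm_nonneg _) zero_le_one, Complex.sq_norm, Complex.normSq_mk]
    linarith
  let e : Circle := ⟨⟨t, -s⟩, mem_sphere_zero_iff_norm.2 hn⟩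
  have hmp := (rotation e).measurePreserving
  have hS : MeasurableSet {z : ℂ | t < z.re} := measurableSet_lt measurable_const (by fun_prop)
  rw [← hmp.setLIntegral_comp_preimage hS (measurable_discWeight p)]
  have h1 : (rotation e) ⁻¹' {z : ℂ | t < z.re} = {z : ℂ | t < t * z.re + s * z.im} := by
    ext z
    change t < (((e : ℂ) * z).re) ↔ _
    simp [e, Complex.mul_re]
  have h2 (z : ℂ) : discWeight p (rotation e z) = discWeight p z := by
    simp only [discWeight, LinearIsometryEquiv.norm_map]
  simp_rw [h1, h2]

lemma lintegral_complex_eq {f : ℂ → ENNReal} (hf : Measurable f) :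
    ∫⁻ z, f z = ∫⁻ u : ℝ, ∫⁻ v : ℝ, f ⟨u, v⟩ := by
  rw [← (Complex.volume_preserving_equiv_real_prod.symm).lintegral_comp hf,
    Measure.volume_eq_prod, lintegral_prod _ (by
      exact (hf.comp Complex.measurableEquivRealProd.symm.measurable).aemeasurable)]
  rfl

/-- Scaling v = √(1 − u²) x factors 1 − u² − v² as (1 − u²)(1 − x²); the Jacobian raises the
exponent of 1 − u² by 1/2, taking p to p + 1. -/
lemma lintegral_slice {p : ℕ} (hp : 1 ≤ p) {u m : ℝ} (hu : u ∈ Ioo (-1 : ℝ) 1)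
    (hm : m ∈ Icc (-1 : ℝ) 1) :
    ∫⁻ v in Ioo (√(1 - u ^ 2) * m) (√(1 - u ^ 2)),
        ENNReal.ofReal ((1 - (u ^ 2 + v ^ 2)) ^ ((p : ℝ) / 2 - 1))
      = ENNReal.ofReal ((1 - u ^ 2) ^ (((p + 1 : ℕ) : ℝ) / 2 - 1))
        * ENNReal.ofReal (beta (1 / 2) ((p : ℝ) / 2) * (1 - projCdf p m)) := by
  have hu2 : 0 < 1 - u ^ 2 := by nlinarith [hu.1, hu.2]
  have hr : 0 < √(1 - u ^ 2) := Real.sqrt_pos.2 hu2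
  have him : (fun x : ℝ => √(1 - u ^ 2) * x) '' Ioo m 1 = Ioo (√(1 - u ^ 2) * m) (√(1 - u ^ 2)) := by
    rw [image_mul_left_Ioo hr, mul_one]
  rw [← him, lintegral_image_eq_lintegral_abs_deriv_mul measurableSet_Ioo
    (f' := fun _ => √(1 - u ^ 2))
    (fun x _ => by simpa using ((hasDerivAt_id x).const_mul √(1 - u ^ 2)).hasDerivWithinAt)
    (fun x _ y _ h => by simpa [hr.ne'] using h), ← lintegral_Ioo_one_sub_sq_rpow hp hm,
    ← lintegral_const_mul' _ _ ENNReal.ofReal_ne_top]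
  apply setLIntegral_congr_fun measurableSet_Ioo
  intro x hx
  have hx2 : 0 < 1 - x ^ 2 := by nlinarith [hx.1, hx.2, hm.1]
  simp only
  rw [← ENNReal.ofReal_mul (by positivity), ← ENNReal.ofReal_mul (by positivity), abs_of_pos hr,
    mul_pow, Real.sq_sqrt hu2.le, show 1 - (u ^ 2 + (1 - u ^ 2) * x ^ 2) = (1 - u ^ 2) * (1 - x ^ 2)
    by ring, Real.mul_rpow hu2.le hx2.le, ← mul_assoc]
  congr 2
  rw [Real.sqrt_eq_rpow, ← Real.rpow_add hu2]
  congr 1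
  push_cast
  ring

lemma norm_mk_lt_one_iff {u v : ℝ} : ‖(⟨u, v⟩ : ℂ)‖ < 1 ↔ u ^ 2 + v ^ 2 < 1 := by
  rw [← sq_lt_one_iff₀ (norm_nonneg _), Complex.sq_norm, Complex.normSq_mk, ← sq, ← sq]

lemma discWeight_mk (p : ℕ) (u v : ℝ) : discWeight p ⟨u, v⟩
    = if u ^ 2 + v ^ 2 < 1 then ENNReal.ofReal ((1 - (u ^ 2 + v ^ 2)) ^ ((p : ℝ) / 2 - 1)) else 0 := by
  simp only [discWeight, norm_mk_lt_one_iff, Complex.sq_norm, Complex.normSq_mk, ← sq]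

/-- The weight of a region of the disc whose vertical slices are bounded below. -/
lemma setLIntegral_discWeight {p : ℕ} (hp : 1 ≤ p) {A : Set ℂ} (hA : MeasurableSet A) {a : ℝ}
    (ha : a ∈ Icc (-1 : ℝ) 1) {m : ℝ → ℝ} (hm : ∀ u ∈ Ioo a 1, m u ∈ Icc (-1 : ℝ) 1)
    (hAm : ∀ u v : ℝ, u ^ 2 + v ^ 2 < 1 →
      ((⟨u, v⟩ : ℂ) ∈ A ↔ a < u ∧ √(1 - u ^ 2) * m u < v)) :
    ∫⁻ z in A, discWeight p z = ∫⁻ u in Ioo a 1,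
      ENNReal.ofReal ((1 - u ^ 2) ^ (((p + 1 : ℕ) : ℝ) / 2 - 1))
        * ENNReal.ofReal (beta (1 / 2) ((p : ℝ) / 2) * (1 - projCdf p (m u))) := by
  rw [← lintegral_indicator hA, lintegral_complex_eq ((measurable_discWeight p).indicator hA),
    ← lintegral_indicator measurableSet_Ioo]
  congr 1
  ext u
  by_cases hu : u ∈ Ioo a 1
  · have hu' : u ∈ Ioo (-1 : ℝ) 1 := ⟨ha.1.trans_lt hu.1, hu.2⟩
    have hu2 : 0 < 1 - u ^ 2 := by nlinarith [hu'.1, hu'.2]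
    rw [indicator_of_mem hu, ← lintegral_slice hp hu' (hm u hu),
      ← lintegral_indicator measurableSet_Ioo]
    congr 1
    ext v
    simp only [indicator, discWeight_mk]
    by_cases hv : u ^ 2 + v ^ 2 < 1
    · have h1 : v < √(1 - u ^ 2) := Real.lt_sqrt_of_sq_lt (by linarith)
      simp only [hAm u v hv, if_pos hv, hu.1, true_and, mem_Ioo, h1, and_true]
    · rw [if_neg hv, ite_self, if_neg]
      rintro ⟨h1, h2⟩
      apply hv
      have h3 : -√(1 - u ^ 2) ≤ √(1 - u ^ 2) * m u := by
        nlinarith [Real.sqrt_nonneg (1 - u ^ 2), (hm u hu).1]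
      have := sq_lt_sq' (h3.trans_lt h1) h2
      rw [Real.sq_sqrt hu2.le] at this
      linarith
  · rw [indicator_of_notMem hu, lintegral_eq_zero_of_ae_eq_zero]
    refine ae_of_all _ fun v => ?_
    simp only [indicator, discWeight_mk]
    by_cases hv : u ^ 2 + v ^ 2 < 1
    · rw [if_neg]
      · rfl
      · exact fun h => hu ⟨((hAm u v hv).1 h).1, by nlinarith⟩
    · rw [if_neg hv, ite_self]; rfl

/-- Both sides are the weight of a half-plane at distance t from the origin, up to a common factor.
The vertical one {t < u} gives the right side. The rotated one is bounded by the chord from (1, 0)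
to (2t² − 1, 2t√(1 − t²)), whence the lower limit 2t² − 1. -/
lemma lintegral_Ioo_mul_one_sub_projCdf {p : ℕ} (hp : 1 ≤ p) {t : ℝ} (ht : t ∈ Ioo (0 : ℝ) 1) :
    ∫⁻ u in Ioo (2 * t ^ 2 - 1) 1, ENNReal.ofReal ((1 - u ^ 2) ^ (((p + 1 : ℕ) : ℝ) / 2 - 1))
        * ENNReal.ofReal (1 - projCdf p (t * (1 - u) / √(1 - u ^ 2) / √(1 - t ^ 2)))
      = ENNReal.ofReal (beta (1 / 2) (((p + 1 : ℕ) : ℝ) / 2) * (1 - projCdf (p + 1) t)) := by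
  have ht0 := ht.1
  have ht2 : 0 < 1 - t ^ 2 := by nlinarith [ht.1, ht.2]
  have hB : 0 < beta (1 / 2) ((p : ℝ) / 2) := beta_pos (by norm_num) (by positivity)
  have hs : 0 < √(1 - t ^ 2) := Real.sqrt_pos.2 ht2
  have hR : ∫⁻ z in {z : ℂ | t < z.re}, discWeight p z
      = ENNReal.ofReal (beta (1 / 2) (((p + 1 : ℕ) : ℝ) / 2) * (1 - projCdf (p + 1) t))
        * ENNReal.ofReal (beta (1 / 2) ((p : ℝ) / 2)) := by
    rw [setLIntegral_discWeight hp (measurableSet_lt measurable_const (by fun_prop))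
      (a := t) ⟨by linarith, ht.2.le⟩ (m := fun _ => -1) (fun _ _ => by norm_num)]
    · have : projCdf p (-1) = 0 := by simp [projCdf]
      rw [lintegral_mul_const' _ _ ENNReal.ofReal_ne_top, lintegral_Ioo_one_sub_sq_rpow (by omega)
        ⟨by linarith, ht.2.le⟩, this, sub_zero, mul_one]
    · intro u v huv
      refine ⟨fun h => ⟨h, ?_⟩, fun h => h.1⟩
      linarith [Real.neg_sqrt_lt_of_sq_lt (show v ^ 2 < 1 - u ^ 2 by linarith)]
  have hL := lintegral_discWeight_rotation p (t := t) (s := √(1 - t ^ 2))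
    (by rw [Real.sq_sqrt ht2.le]; ring)
  have key {u : ℝ} (hu : u ∈ Ioo (-1 : ℝ) 1) : √(1 - u ^ 2)
      * (t * (1 - u) / √(1 - u ^ 2) / √(1 - t ^ 2)) = t * (1 - u) / √(1 - t ^ 2) := by
    have hu2 : 0 < 1 - u ^ 2 := by nlinarith [hu.1, hu.2]
    field_simp
  rw [hR, setLIntegral_discWeight hp (a := 2 * t ^ 2 - 1)
    (m := fun u => t * (1 - u) / √(1 - u ^ 2) / √(1 - t ^ 2))] at hL
  · simp_rw [mul_comm (beta (1 / 2) ((p : ℝ) / 2)), ENNReal.ofReal_mul' hB.le, ← mul_assoc] at hL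
    rw [lintegral_mul_const' _ _ ENNReal.ofReal_ne_top] at hL
    exact (ENNReal.mul_left_inj (ENNReal.ofReal_pos.2 hB).ne' ENNReal.ofReal_ne_top).1 hL
  · exact measurableSet_lt measurable_const (by fun_prop)
  · constructor <;> nlinarith
  · intro u hu
    have hu1 : 0 < 1 - u := by linarith [hu.2]
    have hu2 : 0 < 1 + u := by nlinarith [hu.1]
    have hu3 : 0 < 1 - u ^ 2 := by nlinarith
    have h0 : 0 ≤ t * (1 - u) / √(1 - u ^ 2) / √(1 - t ^ 2) := by positivity
    refine ⟨by linarith, ?_⟩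
    rw [div_div, div_le_one (by positivity), ← Real.sqrt_mul hu3.le]
    apply Real.le_sqrt_of_sq_le
    nlinarith [hu.1, mul_pos hu1 hu1]
  · intro u v huv
    have hu : u ∈ Ioo (-1 : ℝ) 1 := ⟨by nlinarith [sq_nonneg v], by nlinarith [sq_nonneg v]⟩
    have hu1 : 0 < 1 - u := by linarith [hu.2]
    rw [key hu, div_lt_iff₀ hs, mem_ofPred_eq]
    refine ⟨fun h => ⟨?_, by linarith⟩, fun h => by linarith [h.2]⟩
    have h1 : t * (1 - u) < √(1 - t ^ 2) * v := by simp only at h; linarith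
    have h2 : (t * (1 - u)) ^ 2 < (√(1 - t ^ 2) * v) ^ 2 :=
      pow_lt_pow_left₀ h1 (by positivity) two_ne_zero
    rw [mul_pow _ v, Real.sq_sqrt ht2.le] at h2
    -- Combines the squared inequality with v² < 1 − u².
    have h3 : 0 < (1 - u) * (u - (2 * t ^ 2 - 1)) := by nlinarith
    have := (pos_iff_pos_of_mul_pos h3).1 hu1
    linarith

end

/-! ### The zeroth coefficient for q = p + 1 ≥ 2. -/

section
open MeasureTheory Set ProbabilityTheory

lemma lintegral_sin_pow_mul_comp_cos (p : ℕ) {β : ℝ} (hβ : β ∈ Icc 0 Real.pi) (G : ℝ → ENNReal) :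
    ∫⁻ θ in Ioo 0 β, ENNReal.ofReal (Real.sin θ ^ p) * G (Real.cos θ)
      = ∫⁻ u in Ioo (Real.cos β) 1,
          ENNReal.ofReal ((1 - u ^ 2) ^ (((p + 1 : ℕ) : ℝ) / 2 - 1)) * G u := by
  have hanti := Real.strictAntiOn_cos
  have h0 : (0 : ℝ) ∈ Icc 0 Real.pi := ⟨le_rfl, Real.pi_pos.le⟩
  have hmem {x : ℝ} (hx : x ∈ Ioo 0 β) : x ∈ Icc 0 Real.pi := ⟨hx.1.le, hx.2.le.trans hβ.2⟩
  have him : Real.cos '' Ioo 0 β = Ioo (Real.cos β) 1 := by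
    ext y
    constructor
    · rintro ⟨x, hx, rfl⟩
      exact ⟨hanti (hmem hx) hβ hx.2, by simpa using hanti h0 (hmem hx) hx.1⟩
    · intro hy
      have hy1 : -1 ≤ y := (Real.neg_one_le_cos β).trans hy.1.le
      have hc : Real.cos (Real.arccos y) = y := Real.cos_arccos hy1 hy.2.le
      refine ⟨Real.arccos y, ⟨Real.arccos_pos.2 hy.2, ?_⟩, hc⟩
      rw [← hanti.lt_iff_gt hβ ⟨Real.arccos_nonneg y, Real.arccos_le_pi y⟩, hc]
      exact hy.1
  rw [← him, lintegral_image_eq_lintegral_abs_deriv_mul measurableSet_Ioo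
    (fun x _ => (Real.hasDerivAt_cos x).hasDerivWithinAt)
    (hanti.injOn.mono fun x hx => hmem hx)]
  apply setLIntegral_congr_fun measurableSet_Ioo
  intro θ hθ
  have hs : 0 < Real.sin θ := Real.sin_pos_of_pos_of_lt_pi hθ.1 (hθ.2.trans_le hβ.2)
  simp only
  rw [← mul_assoc, ← ENNReal.ofReal_mul (abs_nonneg _), abs_neg, abs_of_pos hs, ← Real.sin_sq,
    ← Real.rpow_natCast_mul hs.le]
  congr 2
  nth_rewrite 2 [← Real.rpow_one (Real.sin θ)]
  rw [← Real.rpow_add hs, ← Real.rpow_natCast]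
  congr 1
  push_cast
  ring

lemma integral_sin_pow_eq_beta (p : ℕ) :
    ∫ θ in (0 : ℝ)..Real.pi, Real.sin θ ^ p = beta (1 / 2) (((p + 1 : ℕ) : ℝ) / 2) := by
  have h := lintegral_sin_pow_mul_comp_cos p (β := Real.pi) ⟨Real.pi_pos.le, le_rfl⟩ 1
  simp only [Pi.one_apply, mul_one, Real.cos_pi] at h
  rw [lintegral_one_sub_sq_rpow (by positivity)] at h
  rw [intervalIntegral.integral_of_le Real.pi_pos.le, integral_Ioc_eq_integral_Ioo,
    integral_eq_lintegral_of_nonneg_ae _ (by fun_prop), h, ENNReal.toReal_ofReal]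
  · exact (beta_pos (by norm_num) (by positivity)).le
  · exact (ae_restrict_iff' measurableSet_Ioo).2 (ae_of_all _ fun θ hθ =>
      pow_nonneg (Real.sin_nonneg_of_nonneg_of_le_pi hθ.1.le hθ.2.le) _)

lemma gegenbauerNorm_zero {p : ℕ} (hp : 1 ≤ p) :
    gegenbauerNorm (p + 1) 0 = beta (1 / 2) (((p + 1 : ℕ) : ℝ) / 2) := by
  have hp0 : (0 : ℝ) < p := by positivity
  have d := Real.Gamma_mul_Gamma_add_half ((p : ℝ) / 2)
  have g : Real.Gamma ((p : ℝ) / 2 + 1) = p / 2 * Real.Gamma (p / 2) :=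
    Real.Gamma_add_one (by positivity)
  have h1 : Real.Gamma ((p : ℝ) / 2) ≠ 0 := (Real.Gamma_pos_of_pos (by positivity)).ne'
  have h2 : (2 : ℝ) ^ (3 - ((p : ℝ) + 1)) = 2 * 2 ^ (1 - (p : ℝ)) := by
    rw [show 3 - ((p : ℝ) + 1) = 1 + (1 - p) by ring, Real.rpow_add two_pos, Real.rpow_one]
  have e1 : 1 / 2 + ((p : ℝ) + 1) / 2 = p / 2 + 1 := by ring
  have e2 : ((p : ℝ) + 1) / 2 = p / 2 + 1 / 2 := by ring
  have e3 : (p : ℝ) + 1 + 0 - 1 = p := by ring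
  have e4 : (p : ℝ) + 1 + 2 * 0 - 1 = p := by ring
  rw [mul_div_cancel₀ _ (two_ne_zero' ℝ)] at d
  simp only [gegenbauerNorm, beta, if_neg (show p + 1 ≠ 1 by omega), Nat.cast_add, Nat.cast_one,
    Nat.cast_zero, h2, e1, e3, e4, Real.Gamma_one_half_eq, g, add_sub_cancel_right,
    Nat.factorial_zero, mul_one]
  rw [e2]
  generalize Real.Gamma ((p : ℝ) / 2 + 1 / 2) = x at *
  generalize Real.Gamma ((p : ℝ) / 2) = y at *
  field_simp
  linear_combination (-√Real.pi) * d
    - ((2 : ℝ) ^ (1 - (p : ℝ)) * Real.Gamma p) * Real.sq_sqrt Real.pi_pos.le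

/-- A primitive of `(1 - u) * (log u - log (1 - u))`. -/
noncomputable def tailLogPrimitive (u : ℝ) : ℝ :=
  u * Real.log u - u - u * (u * Real.log u) / 2 + u ^ 2 / 4
    + (1 - u) * ((1 - u) * Real.log (1 - u)) / 2 - (1 - u) ^ 2 / 4

lemma continuous_tailLogPrimitive : Continuous tailLogPrimitive := by
  have h := Real.continuous_mul_log
  have h' : Continuous fun u : ℝ => (1 - u) * Real.log (1 - u) :=
    h.comp (continuous_const.sub continuous_id)
  unfold tailLogPrimitive
  fun_prop

lemma hasDerivAt_tailLogPrimitive {u : ℝ} (h0 : 0 < u) (h1 : u < 1) :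
    HasDerivAt tailLogPrimitive ((1 - u) * (Real.log u - Real.log (1 - u))) u := by
  have hv : 0 < 1 - u := by linarith
  have i := hasDerivAt_id u
  have j := (hasDerivAt_id u).const_sub 1
  have l := i.mul (Real.hasDerivAt_log h0.ne')
  have l' := j.mul (j.log hv.ne')
  refine (((((l.sub i).sub ((i.mul l).div_const 2)).add
    ((i.pow 2).div_const 4)).add ((j.mul l').div_const 2)).sub
    ((j.pow 2).div_const 4)).congr_deriv ?_
  simp only [id_eq, Pi.mul_apply]
  field_simp
  push_cast
  ring

lemma tailLogPrimitive_sub :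
    tailLogPrimitive 1 - tailLogPrimitive (1 / 2) = -1 / 4 + Real.log 2 / 2 := by
  have h : Real.log (1 / 2) = -Real.log 2 := by rw [one_div, Real.log_inv]
  simp only [tailLogPrimitive, show (1 : ℝ) - 1 / 2 = 1 / 2 by norm_num, h, Real.log_one]
  ring

lemma projCdf_mem_Ioo {q : ℕ} (hq : 1 ≤ q) {t : ℝ} (ht : t ∈ Ioo (0 : ℝ) 1) :
    projCdf q t ∈ Ioo (1 / 2 : ℝ) 1 := by
  have h := projCdf_strictMonoOn hq
  have hm : t ∈ Icc (-1 : ℝ) 1 := ⟨by linarith [ht.1], ht.2.le⟩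
  exact ⟨by simpa [projCdf_zero hq] using h (by norm_num : (0 : ℝ) ∈ Icc (-1 : ℝ) 1) hm ht.1,
    by simpa [projCdf_one_eq_one hq] using h hm (by norm_num : (1 : ℝ) ∈ Icc (-1 : ℝ) 1) ht.2⟩

lemma log_projCdf_div_nonneg {q : ℕ} (hq : 1 ≤ q) {t : ℝ} (ht : t ∈ Ioo (0 : ℝ) 1) :
    0 ≤ Real.log (projCdf q t / (1 - projCdf q t)) := by
  have h := projCdf_mem_Ioo hq ht
  apply Real.log_nonneg
  rw [le_div_iff₀ (by linarith [h.2])]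
  linarith [h.1]

/-- The substitution u = F_q(t), with u running from 1/2 to 1, makes the integrand an exact
derivative. -/
lemma integral_log_projCdf {q : ℕ} (hq : 1 ≤ q) (B : ℝ) (hB : 0 < B) :
    IntegrableOn (fun t => Real.log (projCdf q t / (1 - projCdf q t)) * projDensity q t
        * (B * (1 - projCdf q t))) (Ioo 0 1) ∧
      ∫ t in Ioo (0 : ℝ) 1, Real.log (projCdf q t / (1 - projCdf q t)) * projDensity q t
        * (B * (1 - projCdf q t)) = B * (-1 / 4 + Real.log 2 / 2) := by
  have hc : ContinuousOn (fun t => B * tailLogPrimitive (projCdf q t)) (Icc (0 : ℝ) 1) :=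
    continuousOn_const.mul (continuous_tailLogPrimitive.comp_continuousOn
      ((continuousOn_projCdf hq).mono (Icc_subset_Icc_left (by norm_num))))
  have hd : ∀ t ∈ Ioo (0 : ℝ) 1, HasDerivAt (fun t => B * tailLogPrimitive (projCdf q t))
      (Real.log (projCdf q t / (1 - projCdf q t)) * projDensity q t
        * (B * (1 - projCdf q t))) t := by
    intro t ht
    have h := projCdf_mem_Ioo hq ht
    have h0 : 0 < projCdf q t := by linarith [h.1]
    refine (((hasDerivAt_tailLogPrimitive h0 h.2).comp t
      (hasDerivAt_projCdf hq ⟨by linarith [ht.1], ht.2⟩)).const_mul B).congr_deriv ?_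
    rw [Real.log_div h0.ne' (by linarith [h.2])]
    ring
  have h0 : ∀ t ∈ Ioo (0 : ℝ) 1, 0 ≤ Real.log (projCdf q t / (1 - projCdf q t)) * projDensity q t
        * (B * (1 - projCdf q t)) := by
    intro t ht
    have := log_projCdf_div_nonneg hq ht
    have := (projDensity_pos hq ⟨by linarith [ht.1], ht.2⟩ : 0 < projDensity q t)
    have : 0 < 1 - projCdf q t := by linarith [(projCdf_mem_Ioo hq ht).2]
    positivity
  refine ⟨(intervalIntegral.integrableOn_deriv_of_nonneg hc hd h0).mono_set
    Ioo_subset_Ioc_self, ?_⟩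
  rw [← integral_Ioc_eq_integral_Ioo, ← intervalIntegral.integral_of_le zero_le_one,
    integral_deriv_eq_sub_of_nonneg zero_le_one hc hd h0, projCdf_zero hq, projCdf_one_eq_one hq,
    ← mul_sub, tailLogPrimitive_sub]

lemma cos_half_pos {θ : ℝ} (hθ : θ ∈ Ioo 0 Real.pi) : 0 < Real.cos (θ / 2) :=
  Real.cos_pos_of_mem_Ioo ⟨by linarith [hθ.1, hθ.2], by linarith [hθ.2]⟩

lemma sin_half_pos {θ : ℝ} (hθ : θ ∈ Ioo 0 Real.pi) : 0 < Real.sin (θ / 2) :=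
  Real.sin_pos_of_pos_of_lt_pi (by linarith [hθ.1]) (by linarith [hθ.1, hθ.2])

lemma mul_tan_half_div_mem_Icc {θ t : ℝ} (hθ : θ ∈ Ioo 0 Real.pi) (ht : t ∈ Ioo 0 (Real.cos (θ / 2))) :
    t * Real.tan (θ / 2) / √(1 - t ^ 2) ∈ Icc (-1 : ℝ) 1 := by
  have hc := cos_half_pos hθ
  have hs := sin_half_pos hθ
  have hsq := Real.sin_sq_add_cos_sq (θ / 2)
  have hc1 : Real.cos (θ / 2) < 1 := by nlinarith
  have ha : t * Real.tan (θ / 2) / √(1 - t ^ 2) = capCos (Real.cos (θ / 2)) t := by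
    rw [capCos, ← Real.sin_sq, Real.sqrt_sq hs.le, Real.tan_eq_sin_div_cos]
    field_simp
  rw [ha]
  exact ⟨by linarith [capCos_nonneg hc ht.1.le], (capCos_lt_one hc hc1 ht.1.le ht.2).le⟩

/-- With u = cos θ, tan(θ/2) = (1 − u)/√(1 − u²), and θ < 2 arccos t becomes u > 2t² − 1: this is
the disc computation in the angle. -/
lemma lintegral_one_sub_projCdf_mul_sin_pow {p : ℕ} (hp : 1 ≤ p) {t : ℝ} (ht : t ∈ Ioo (0 : ℝ) 1) :
    ∫⁻ θ in Ioo 0 (2 * Real.arccos t), ENNReal.ofReal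
        ((1 - projCdf p (t * Real.tan (θ / 2) / √(1 - t ^ 2))) * Real.sin θ ^ p)
      = ENNReal.ofReal (beta (1 / 2) (((p + 1 : ℕ) : ℝ) / 2) * (1 - projCdf (p + 1) t)) := by
  have h0 := Real.arccos_nonneg t
  have h1 : 2 * Real.arccos t < Real.pi := by
    linarith [Real.arccos_lt_pi_div_two.2 ht.1]
  have hc : Real.cos (2 * Real.arccos t) = 2 * t ^ 2 - 1 := by
    rw [Real.cos_two_mul, Real.cos_arccos (by linarith [ht.1]) ht.2.le]
  rw [← lintegral_Ioo_mul_one_sub_projCdf hp ht, ← hc,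
    ← lintegral_sin_pow_mul_comp_cos p ⟨by linarith, h1.le⟩ (fun u => ENNReal.ofReal
      (1 - projCdf p (t * (1 - u) / √(1 - u ^ 2) / √(1 - t ^ 2))))]
  apply setLIntegral_congr_fun measurableSet_Ioo
  intro θ hθ
  have hθ' : θ ∈ Ioo 0 Real.pi := ⟨hθ.1, hθ.2.trans h1⟩
  have hs : 0 < Real.sin θ := Real.sin_pos_of_pos_of_lt_pi hθ'.1 hθ'.2
  have hs2 := sin_half_pos hθ'
  have hc2 := cos_half_pos hθ'
  have e1 : Real.cos θ = 1 - 2 * Real.sin (θ / 2) ^ 2 := by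
    rw [← Real.cos_two_mul_eq_one_sub, mul_div_cancel₀ _ two_ne_zero]
  have e2 : Real.sin θ = 2 * Real.sin (θ / 2) * Real.cos (θ / 2) := by
    rw [← Real.sin_two_mul, mul_div_cancel₀ _ two_ne_zero]
  have e3 : t * (1 - Real.cos θ) / √(1 - Real.cos θ ^ 2) = t * Real.tan (θ / 2) := by
    rw [← Real.sin_sq, Real.sqrt_sq hs.le, e1, e2, Real.tan_eq_sin_div_cos]
    field_simp
    ring
  simp only [e3]
  rw [ENNReal.ofReal_mul' (by positivity), mul_comm]

lemma coeffAD_zero {p : ℕ} (hp : 1 ≤ p) : coeffAD (p + 1) 0 = -1 := by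
  have hq : 1 ≤ p + 1 := by omega
  set B := beta (1 / 2) (((p + 1 : ℕ) : ℝ) / 2) with hBdef
  have hB : 0 < B := beta_pos (by norm_num) (by positivity)
  -- Extending the distribution functions by constants makes them measurable on the whole line.
  let Fc : ℕ → ℝ → ℝ := fun q y => projCdf q (projIcc (-1) 1 (by norm_num) y)
  have hFc (q : ℕ) (hq : 1 ≤ q) : Measurable (Fc q) :=
    ((continuousOn_projCdf hq).domRestrict.comp continuous_projIcc).measurable
  have hFc' (q : ℕ) {y : ℝ} (hy : y ∈ Icc (-1 : ℝ) 1) : Fc q y = projCdf q y := by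
    simp only [Fc, projIcc_of_mem _ hy]
  let S : Set (ℝ × ℝ) := {x | (0 < x.1 ∧ x.1 < Real.pi) ∧ 0 < x.2 ∧ x.2 < Real.cos (x.1 / 2)}
  have hS : MeasurableSet S :=
    ((measurableSet_lt measurable_const measurable_fst).inter
      (measurableSet_lt measurable_fst measurable_const)).inter
    ((measurableSet_lt measurable_const measurable_snd).inter
      (measurableSet_lt measurable_snd (by fun_prop)))
  let w : ℝ → ℝ := fun t => Real.log (Fc (p + 1) t / (1 - Fc (p + 1) t)) * projDensity (p + 1) t
  let A : ℝ → ℝ → ℝ := fun θ t => 1 - Fc p (t * Real.tan (θ / 2) / √(1 - t ^ 2))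
  let g : ℝ → ℝ → ℝ := fun θ t => S.indicator
    (fun x => w x.2 * (A x.1 x.2 * Real.sin x.1 ^ p)) (θ, t)
  have hw : Measurable w := by
    have := hFc (p + 1) hq
    have := measurable_projDensity (p + 1)
    simp only [w]
    fun_prop
  have htan : Measurable Real.tan := by
    simp_rw [funext Real.tan_eq_sin_div_cos]
    fun_prop
  have hA : Measurable (Function.uncurry A) := by
    have := hFc p hp
    refine measurable_const.sub (this.comp ?_)
    fun_prop
  have hg : Measurable (Function.uncurry g) :=
    ((hw.comp measurable_snd).mul
      (hA.mul ((Real.measurable_sin.comp measurable_fst).pow_const p))).indicator hS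
  have hA0 {θ t : ℝ} (hθ : θ ∈ Ioo 0 Real.pi) (ht : t ∈ Ioo 0 (Real.cos (θ / 2))) :
      0 ≤ A θ t := by
    have hm := mul_tan_half_div_mem_Icc hθ ht
    simp only [A, hFc' p hm]
    have := (projCdf_strictMonoOn hp).monotoneOn hm (by norm_num : (1 : ℝ) ∈ Icc (-1 : ℝ) 1) hm.2
    rw [projCdf_one_eq_one hp] at this
    linarith
  have hw' {t : ℝ} (ht : t ∈ Ioo (0 : ℝ) 1) :
      w t = Real.log (projCdf (p + 1) t / (1 - projCdf (p + 1) t)) * projDensity (p + 1) t := by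
    simp only [w, hFc' (p + 1) (show t ∈ Icc (-1 : ℝ) 1 from ⟨by linarith [ht.1], ht.2.le⟩)]
  have hw0 {t : ℝ} (ht : t ∈ Ioo (0 : ℝ) 1) : 0 ≤ w t := by
    rw [hw' ht]
    exact mul_nonneg (log_projCdf_div_nonneg hq ht)
      (projDensity_pos hq ⟨by linarith [ht.1], ht.2⟩).le
  have g0 (θ t : ℝ) : 0 ≤ g θ t := by
    refine indicator_nonneg (fun x hx => ?_) _
    exact mul_nonneg (hw0 ⟨hx.2.1, hx.2.2.trans_le (Real.cos_le_one _)⟩)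
      (mul_nonneg (hA0 hx.1 hx.2)
        (pow_nonneg (Real.sin_nonneg_of_nonneg_of_le_pi hx.1.1.le hx.1.2.le) _))
  obtain ⟨hint, hval⟩ := integral_log_projCdf hq B hB
  have inner_θ : ∀ t ∈ Ioo (0 : ℝ) 1, ∫⁻ θ in Ioo 0 Real.pi, ENNReal.ofReal (g θ t)
      = ENNReal.ofReal (Real.log (projCdf (p + 1) t / (1 - projCdf (p + 1) t))
        * projDensity (p + 1) t * (B * (1 - projCdf (p + 1) t))) := by
    intro t ht
    have h1 : 2 * Real.arccos t < Real.pi := by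
      linarith [Real.arccos_lt_pi_div_two.2 ht.1]
    -- For fixed t the constraint t < cos(θ/2) reads θ < 2 arccos t.
    have hmem (θ : ℝ) (hθ : θ ∈ Ioo 0 Real.pi) : (θ, t) ∈ S ↔ θ ∈ Ioo 0 (2 * Real.arccos t) := by
      have : t < Real.cos (θ / 2) ↔ θ < 2 * Real.arccos t := by
        rw [← Real.cos_arccos (show -1 ≤ t by linarith [ht.1]) ht.2.le,
          Real.strictAntiOn_cos.lt_iff_gt ⟨Real.arccos_nonneg t, Real.arccos_le_pi t⟩
          ⟨by linarith [hθ.1], by linarith [hθ.1, hθ.2]⟩,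
          Real.cos_arccos (show -1 ≤ t by linarith [ht.1]) ht.2.le, div_lt_iff₀' two_pos]
      exact ⟨fun h => ⟨hθ.1, this.1 h.2.2⟩, fun h => ⟨hθ, ht.1, this.2 h.2⟩⟩
    have e : ∀ θ ∈ Ioo 0 Real.pi, ENNReal.ofReal (g θ t) = (Ioo 0 (2 * Real.arccos t)).indicator
        (fun θ => ENNReal.ofReal (w t) * ENNReal.ofReal
          ((1 - projCdf p (t * Real.tan (θ / 2) / √(1 - t ^ 2))) * Real.sin θ ^ p)) θ := by
      intro θ hθ
      by_cases h : θ ∈ Ioo 0 (2 * Real.arccos t)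
      · have hθS := (hmem θ hθ).2 h
        rw [indicator_of_mem h]
        simp only [g, A]
        rw [indicator_of_mem hθS, ENNReal.ofReal_mul (hw0 ht),
          hFc' p (mul_tan_half_div_mem_Icc hθ hθS.2)]
      · rw [indicator_of_notMem h]
        simp only [g]
        rw [indicator_of_notMem (fun hm => h ((hmem θ hθ).1 hm)), ENNReal.ofReal_zero]
    rw [setLIntegral_congr_fun measurableSet_Ioo e, lintegral_indicator measurableSet_Ioo,
      Measure.restrict_restrict measurableSet_Ioo, inter_eq_left.2 (Ioo_subset_Ioo_right h1.le),
      lintegral_const_mul' _ _ ENNReal.ofReal_ne_top, lintegral_one_sub_projCdf_mul_sin_pow hp ht,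
      ← ENNReal.ofReal_mul (hw0 ht), hw' ht]
  have inner_t : ∀ θ ∈ Ioo 0 Real.pi, ∫ t in Ioo (0 : ℝ) 1, g θ t
      = (∫ t in (0 : ℝ)..Real.cos (θ / 2),
          Real.log (projCdf (p + 1) t / (1 - projCdf (p + 1) t))
            * (1 - projCdf p (t * Real.tan (θ / 2) / √(1 - t ^ 2)))
            * projDensity (p + 1) t) * Real.sin θ ^ p := by
    intro θ hθ
    have hc := cos_half_pos hθ
    have hc1 := Real.cos_le_one (θ / 2)
    have e (t : ℝ) : g θ t = (Ioo 0 (Real.cos (θ / 2))).indicator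
        (fun t => Real.log (projCdf (p + 1) t / (1 - projCdf (p + 1) t))
            * (1 - projCdf p (t * Real.tan (θ / 2) / √(1 - t ^ 2)))
            * projDensity (p + 1) t * Real.sin θ ^ p) t := by
      by_cases h : t ∈ Ioo 0 (Real.cos (θ / 2))
      · rw [indicator_of_mem h]
        simp only [g, A]
        rw [indicator_of_mem (show (θ, t) ∈ S from ⟨hθ, h⟩), hw' ⟨h.1, h.2.trans_le hc1⟩,
          hFc' p (mul_tan_half_div_mem_Icc hθ h)]
        ring
      · rw [indicator_of_notMem h]
        simp only [g]
        rw [indicator_of_notMem (fun hm : (θ, t) ∈ S => h hm.2)]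
    simp_rw [e]
    rw [integral_indicator measurableSet_Ioo, Measure.restrict_restrict measurableSet_Ioo,
      inter_eq_left.2 (Ioo_subset_Ioo_right hc1), integral_mul_const,
      ← integral_Ioc_eq_integral_Ioo, ← intervalIntegral.integral_of_le hc.le]
  obtain ⟨T1, T2⟩ := integrable_and_integral_integral_of_lintegral_eq
    (μ := volume.restrict (Ioo 0 Real.pi)) (ν := volume.restrict (Ioo 0 1)) hg g0 hint
    ((ae_restrict_iff' measurableSet_Ioo).2 (ae_of_all _ fun t ht => mul_nonneg
      (mul_nonneg (log_projCdf_div_nonneg hq ht) (projDensity_pos hq ⟨by linarith [ht.1], ht.2⟩).le)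
      (mul_nonneg hB.le (by linarith [(projCdf_mem_Ioo hq ht).2]))))
    ((ae_restrict_iff' measurableSet_Ioo).2 (ae_of_all _ inner_θ))
  have psi : ∫ θ in Ioo 0 Real.pi, psiAD (p + 1) θ * Real.sin θ ^ p = -B := by
    have hsin : IntegrableOn (fun θ => Real.sin θ ^ p) (Ioo 0 Real.pi) :=
      ((by fun_prop : Continuous fun θ => Real.sin θ ^ p).integrableOn_Icc).mono_set
        Ioo_subset_Icc_self
    have hsin' : ∫ θ in Ioo 0 Real.pi, Real.sin θ ^ p = B := by
      rw [← integral_Ioc_eq_integral_Ioo, ← intervalIntegral.integral_of_le Real.pi_pos.le,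
        integral_sin_pow_eq_beta]
    have e : ∀ θ ∈ Ioo 0 Real.pi, psiAD (p + 1) θ * Real.sin θ ^ p
        = -Real.log 4 * Real.sin θ ^ p + 4 * ∫ t in Ioo (0 : ℝ) 1, g θ t := by
      intro θ hθ
      rw [inner_t θ hθ, psiAD, if_neg (by omega)]
      simp only [add_tsub_cancel_right]
      ring
    -- The total is −B log 4 + 4B(−1/4 + (log 2)/2) = −B.
    rw [setIntegral_congr_fun measurableSet_Ioo e,
      integral_add (hsin.const_mul _) (T1.const_mul _), integral_const_mul, integral_const_mul, T2,
      hval, hsin', show (4 : ℝ) = 2 ^ 2 by norm_num, Real.log_pow]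
    push_cast
    ring
  rw [coeffAD, gegenbauerCoeff, if_neg (by omega), gegenbauerNorm_zero hp, ← hBdef]
  simp only [gegenbauerPoly, eval_one, mul_one, add_tsub_cancel_right]
  rw [intervalIntegral.integral_of_le Real.pi_pos.le, integral_Ioc_eq_integral_Ioo, psi]
  field_simp

end

theorem mainTheorem12 :
    (∀ k : ℕ, 1 ≤ k →
      coeffAD 1 k = 1 / (Real.pi * (k : ℝ) ^ 2)
        * ∫ θ in (0 : ℝ)..Real.pi, (1 - Real.cos (2 * k * θ)) / ((Real.pi - θ) * θ)) ∧
    (∀ k : ℕ, 1 ≤ k → coeffAD 2 k = 1 / ((k : ℝ) * ((k : ℝ) + 1))) ∧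
    (∀ q : ℕ, 1 ≤ q → coeffAD q 0 = -1) ∧
    (∀ q : ℕ, q = 1 ∨ q = 2 → ∀ k : ℕ, 1 ≤ k → 0 < coeffAD q k) := by
  have h2 := coeffAD_two_of_psiAD_eq fun θ hθ => psiAD_two hθ
  refine ⟨coeffAD_one, h2, ?_, ?_⟩
  · rintro q hq
    obtain ⟨p, rfl⟩ := Nat.exists_eq_add_of_le' hq
    rcases Nat.eq_zero_or_pos p with rfl | hp
    · exact coeffAD_one_zero
    · exact coeffAD_zero hp
  · rintro q (rfl | rfl) k hk
    · exact coeffAD_one_pos k hk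
    · have hk0 : (0 : ℝ) < k := by positivity
      rw [h2 k hk]
      positivity
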